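/- Let $X$ be a locally compact Hausdorff space. A complex vector bundle $\mathcal V=[E,p,X]$ is a locally trivial family of nonzero finite-dimensional complex vector spaces $p^{-1}(x)$, $x\in X$ (the rank is locally constant but may vary over $X$); a metric $\beta$ on $\mathcal V$ is a continuous map from the total space of $\mathcal V\oplus\mathcal V$ to $\mathbb C$ that restricts to an inner product on each fibre. Let $\Gamma_0(\mathcal V)$ be the space of continuous sections $\xi$ of $\mathcal V$ for which $x\mapsto\beta(\xi(x),\xi(x))$ vanishes at infinity, with $(\xi f)(x)=\xi(x)f(x)$ for $f\in C_0(X)$ and $\langle\xi,\eta\rangle(x)=\beta(\xi(x),\eta(x))$. For a Hilbert $C_0(X)$-module $\mathcal E$ and a compact set $K\subseteq X$, let $\mathcal E_K=\mathcal E/\mathcal E C_0(X\setminus K)$, a Hilbert module over $C(K)\cong C_0(X)/C_0(X\setminus K)$. The module $\mathcal E$ is called $\sigma$-finitely generated if for every compact $K\subseteq X$ there is a finite subset of $\mathcal E_K$ whose $C(K)$-linear span is dense in $\mathcal E_K$; it is called $\sigma$-projective if for every compact $K\subseteq X$ the $C(K)$-module $\mathcal E_K$ is projective, i.e. an (algebraic)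 direct summand of a free $C(K)$-module; it is called full if the closed linear span of $\{\langle\xi,\eta\rangle:\xi,\eta\in\mathcal E\}$ is $C_0(X)$. Then: (1) For every complex vector bundle $\mathcal V$ over $X$ and every metric $\beta$ on $\mathcal V$, $\Gamma_0(\mathcal V)$ is a (complete) Hilbert $C_0(X)$-module that is $\sigma$-finitely generated and $\sigma$-projective. (2) Conversely, for every full, $\sigma$-finitely generated and $\sigma$-projective Hilbert $C_0(X)$-module $\mathcal E$ there are a complex vector bundle $\mathcal V$ over $X$, a metric $\beta$ on $\mathcal V$ and a linear bijection $T:\mathcal E\to\Gamma_0(\mathcal V)$ with $T(\xi f)=T(\xi)f$ and $\langle T\xi,T\eta\rangle=\langle\xi,\eta\rangle$ for all $\xi,\eta\in\mathcal E$, $f\in C_0(X)$. -/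

import Mathlib

open Filter Topology Bundle
open scoped ZeroAtInfty ComplexOrder

universe u v w

noncomputable section

/-! ### The C⋆-algebra `C₀(X)` with its pointwise order -/

section Order

variable {X : Type u} [TopologicalSpace X]

/-- The pointwise order on `C₀(X, ℂ)`. -/
instance C0.instPartialOrder : PartialOrder C₀(X, ℂ) :=
  PartialOrder.lift (fun f => (f : X → ℂ)) DFunLike.coe_injective

theorem C0.le_def {f g : C₀(X, ℂ)} : f ≤ g ↔ ∀ x, f x ≤ g x := Iff.rfl

/-- The pointwise order is the usual order of the C⋆-algebra `C₀(X, ℂ)`. -/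
instance C0.instStarOrderedRing : StarOrderedRing C₀(X, ℂ) := by
  refine StarOrderedRing.of_le_iff fun f g => ⟨fun h => ?_, ?_⟩
  · refine ⟨⟨⟨fun x => ((Real.sqrt ((g x - f x).re) : ℝ) : ℂ), ?_⟩, ?_⟩, ?_⟩
    · have := g.continuous.sub f.continuous
      exact Complex.continuous_ofReal.comp
        (Real.continuous_sqrt.comp (Complex.continuous_re.comp this))
    · have h0 : Tendsto (fun x => g x - f x) (cocompact X) (𝓝 0) := by
        simpa using (zero_at_infty g).sub (zero_at_infty f)
      have h1 : Continuous fun z : ℂ => ((Real.sqrt z.re : ℝ) : ℂ) := by fun_prop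
      have h2 := (h1.tendsto 0).comp h0
      simp only [Complex.zero_re, Real.sqrt_zero, Complex.ofReal_zero] at h2
      exact h2
    · ext x
      have hx : f x ≤ g x := h x
      have h1 : 0 ≤ (g x - f x).re := by
        simpa using (Complex.le_def.1 hx).1
      have h2 : (g x - f x).im = 0 := by
        simp [(Complex.le_def.1 hx).2]
      have h3 : ((Real.sqrt ((g x - f x).re) : ℝ) : ℂ) * (Real.sqrt ((g x - f x).re) : ℝ)
          = g x - f x := by
        rw [← Complex.ofReal_mul, Real.mul_self_sqrt h1]
        exact Complex.ext (by simp) (by simp [h2])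
      simp only [ZeroAtInftyContinuousMap.add_apply, ZeroAtInftyContinuousMap.mul_apply,
        ZeroAtInftyContinuousMap.star_apply, ZeroAtInftyContinuousMap.coe_mk]
      have h4 : star ((Real.sqrt ((g x - f x).re) : ℝ) : ℂ) = (Real.sqrt ((g x - f x).re) : ℝ) :=
        Complex.conj_ofReal _
      erw [h4, h3]
      ring
  · rintro ⟨s, rfl⟩ x
    simp only [ZeroAtInftyContinuousMap.add_apply, ZeroAtInftyContinuousMap.mul_apply,
        ZeroAtInftyContinuousMap.star_apply]
    exact le_add_of_nonneg_right (star_mul_self_nonneg _)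

end Order

/-! ### Hilbert `C₀(X)`-modules

A Hilbert `C₀(X)`-module is a complete `CStarModule C₀(X, ℂ) E`. As `C₀(X)` is commutative,
the right action `ξ f` is written `f • ξ`; the usual laws of the action follow from those of the
inner product. -/

namespace HilbertC0

section Action

variable {X : Type u} [TopologicalSpace X] {E : Type v} [NormedAddCommGroup E] [NormedSpace ℂ E]
  [SMul C₀(X, ℂ) E] [CStarModule C₀(X, ℂ) E]

variable (X) in
theorem ext_inner {x y : E} (h : ∀ z : E, inner C₀(X, ℂ) z x = inner C₀(X, ℂ) z y) : x = y := by
  rw [← sub_eq_zero, ← CStarModule.inner_self (A := C₀(X, ℂ)), CStarModule.inner_sub_right, h,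
    sub_self]

theorem smul_add' (f : C₀(X, ℂ)) (x y : E) : f • (x + y) = f • x + f • y :=
  ext_inner X fun z => by simp [mul_add]

theorem add_smul' (f g : C₀(X, ℂ)) (x : E) : (f + g) • x = f • x + g • x :=
  ext_inner X fun z => by simp [add_mul]

theorem sub_smul' (f g : C₀(X, ℂ)) (x : E) : (f - g) • x = f • x - g • x :=
  ext_inner X fun z => by simp [sub_mul]

theorem mul_smul' (f g : C₀(X, ℂ)) (x : E) : (f * g) • x = f • g • x :=
  ext_inner X fun z => by simp [mul_assoc]

theorem smul_comm' (f : C₀(X, ℂ)) (c : ℂ) (x : E) : f • c • x = c • f • x :=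
  ext_inner X fun z => by simp [mul_smul_comm]

theorem norm_smul_le' (f : C₀(X, ℂ)) (x : E) : ‖f • x‖ ≤ ‖f‖ * ‖x‖ := by
  have h : ‖f • x‖ ^ 2 ≤ (‖f‖ * ‖x‖) ^ 2 := by
    rw [mul_pow, CStarModule.norm_sq_eq C₀(X, ℂ), CStarModule.norm_sq_eq C₀(X, ℂ) (x := x),
      CStarModule.inner_op_smul_right, CStarModule.inner_op_smul_left]
    calc _ ≤ ‖f‖ * (‖inner C₀(X, ℂ) x x‖ * ‖star f‖) :=
          (norm_mul_le _ _).trans (by gcongr; exact norm_mul_le _ _)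
      _ = _ := by rw [norm_star (E := C₀(X, ℂ))]; ring
  exact le_of_sq_le_sq h (by positivity)

/-- The action of `f ∈ C₀(X)` on `E`, as a continuous linear map. -/
def smulCLM (f : C₀(X, ℂ)) : E →L[ℂ] E :=
  LinearMap.mkContinuous
    { toFun := fun x => f • x
      map_add' := smul_add' f
      map_smul' := fun c x => smul_comm' f c x } ‖f‖ (norm_smul_le' f)

@[simp] theorem smulCLM_apply (f : C₀(X, ℂ)) (x : E) : smulCLM f x = f • x := rfl

theorem norm_le_of_forall {f : C₀(X, ℂ)} {c : ℝ} (hc : 0 ≤ c) (h : ∀ x, ‖f x‖ ≤ c) : ‖f‖ ≤ c := by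
  rw [← ZeroAtInftyContinuousMap.norm_toBCF_eq_norm]
  exact (BoundedContinuousFunction.norm_le hc).2 h

theorem norm_apply_le (f : C₀(X, ℂ)) (x : X) : ‖f x‖ ≤ ‖f‖ := by
  rw [← ZeroAtInftyContinuousMap.norm_toBCF_eq_norm]
  exact f.toBCF.norm_coe_le_norm x

variable (X) in
/-- Every element is approximated by its multiples with functions in `C₀(X)`. -/
theorem exists_norm_sub_smul_lt (ξ : E) {ε : ℝ} (hε : 0 < ε) :
    ∃ b : C₀(X, ℂ), ‖ξ - b • ξ‖ < ε := by
  set h : C₀(X, ℂ) := inner C₀(X, ℂ) ξ ξ with hh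
  obtain ⟨δ, hδ, hδε⟩ : ∃ δ : ℝ, 0 < δ ∧ δ < ε ^ 2 := exists_between (by positivity)
  have hpos : ∀ z : ℂ, δ + ‖z‖ ≠ 0 := fun z => by positivity
  have hcont : Continuous fun z : ℂ => ((‖z‖ / (δ + ‖z‖) : ℝ) : ℂ) :=
    Complex.continuous_ofReal.comp (continuous_norm.div (by fun_prop) hpos)
  let b : C₀(X, ℂ) := ⟨⟨fun x => ((‖h x‖ / (δ + ‖h x‖) : ℝ) : ℂ), hcont.comp h.continuous⟩, by
    have := (hcont.tendsto 0).comp (zero_at_infty h)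
    simp only [norm_zero, zero_div, Complex.ofReal_zero] at this
    exact this⟩
  have hb : ∀ x, b x = ((‖h x‖ / (δ + ‖h x‖) : ℝ) : ℂ) := fun x => rfl
  refine ⟨b, ?_⟩
  have h1 : ‖ξ - b • ξ‖ ^ 2 ≤ δ := by
    rw [CStarModule.norm_sq_eq C₀(X, ℂ)]
    refine norm_le_of_forall hδ.le fun x => ?_
    have h2 : (inner C₀(X, ℂ) (ξ - b • ξ) (ξ - b • ξ) : C₀(X, ℂ)) x
        = h x * ((δ / (δ + ‖h x‖) : ℝ) : ℂ) ^ 2 := by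
      have h3 : star (b x) = b x := by rw [hb]; exact Complex.conj_ofReal _
      have h4 : ((δ / (δ + ‖h x‖) : ℝ) : ℂ) = 1 - b x := by
        rw [hb, ← Complex.ofReal_one, ← Complex.ofReal_sub]
        congr 1
        have := hpos (h x)
        field_simp
        ring
      simp only [CStarModule.inner_sub_left, CStarModule.inner_sub_right,
        CStarModule.inner_op_smul_left, CStarModule.inner_op_smul_right, ← hh,
        ZeroAtInftyContinuousMap.sub_apply, ZeroAtInftyContinuousMap.mul_apply,
        ZeroAtInftyContinuousMap.star_apply, h3, h4]
      ring
    rw [h2, norm_mul, norm_pow, Complex.norm_real, Real.norm_of_nonneg (by positivity), div_pow,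
      mul_div_assoc', div_le_iff₀ (by positivity)]
    nlinarith [norm_nonneg (h x), hδ, mul_nonneg hδ.le (norm_nonneg (h x)), sq_nonneg ‖h x‖,
      mul_nonneg hδ.le (sq_nonneg ‖h x‖), mul_nonneg (sq_nonneg δ) (norm_nonneg (h x)),
      pow_pos hδ 3]
  exact lt_of_pow_lt_pow_left₀ 2 hε.le (h1.trans_lt hδε)

end Action

/-- `E` is full: the closed linear span of the inner products is all of `C₀(X)`. -/
def IsFull (X : Type u) [TopologicalSpace X] (E : Type v) [NormedAddCommGroup E]
    [NormedSpace ℂ E] [SMul C₀(X, ℂ) E] [CStarModule C₀(X, ℂ) E] : Prop :=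
  closure (Submodule.span ℂ
    (Set.range fun p : E × E => inner C₀(X, ℂ) p.1 p.2) : Set C₀(X, ℂ)) = Set.univ

/-! ### The restriction `E_K = E / E C₀(X \ K)` to a compact set `K`, as a `C(K)`-module -/

section Restriction

variable {X : Type u} [TopologicalSpace X]

/-- The submodule `E C₀(X \ K)`, the closed linear span of all `f • ξ` with `f ∈ C₀(X)` vanishing
on `K`. (If `E` is complete, every element of it is itself of the form `f • ξ`, by Cohen
factorization.) -/
def idealSubmodule (E : Type v) [NormedAddCommGroup E] [NormedSpace ℂ E]
    [SMul C₀(X, ℂ) E] [CStarModule C₀(X, ℂ) E] (K : TopologicalSpace.Compacts X) :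
    Submodule ℂ E :=
  (Submodule.span ℂ
    {ζ : E | ∃ (f : C₀(X, ℂ)) (ξ : E), (∀ x ∈ K, f x = 0) ∧ ζ = f • ξ}).topologicalClosure

/-- The quotient `E_K = E / E C₀(X \ K)`. -/
def Restriction (E : Type v) [NormedAddCommGroup E] [NormedSpace ℂ E]
    [SMul C₀(X, ℂ) E] [CStarModule C₀(X, ℂ) E] (K : TopologicalSpace.Compacts X) : Type v :=
  E ⧸ idealSubmodule E K

/-- Every continuous function on a compact set extends to a function in `C₀(X)`. -/
theorem exists_extension [LocallyCompactSpace X] [T2Space X] (K : TopologicalSpace.Compacts X)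
    (g : C(K, ℂ)) : ∃ f : C₀(X, ℂ), ∀ x : K, f x = g x := by
  have : CompactSpace K := isCompact_iff_compactSpace.1 K.isCompact
  have hemb : IsClosedEmbedding (fun x : K => ((x : X) : OnePoint X)) :=
    (OnePoint.continuous_coe.comp continuous_subtype_val).isClosedEmbedding
      (OnePoint.coe_injective.comp Subtype.val_injective)
  obtain ⟨G, hG⟩ := g.exists_extension' hemb
  obtain ⟨k, hk1, -, hk, -⟩ := exists_continuous_one_zero_of_isCompact K.isCompact
    isClosed_empty (Set.disjoint_empty _)
  refine ⟨⟨⟨fun x => (k x : ℂ) * G (x : OnePoint X), ?_⟩, ?_⟩, fun x => ?_⟩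
  · exact (Complex.continuous_ofReal.comp k.continuous).mul
      (G.continuous.comp OnePoint.continuous_coe)
  · refine HasCompactSupport.is_zero_at_infty ?_
    exact (hk.comp_left (g := fun t : ℝ => (t : ℂ)) Complex.ofReal_zero).mul_right
  · have h1 : k x = 1 := hk1 x.2
    have h2 : G ((x : X) : OnePoint X) = g x := congrFun hG x
    change (k x : ℂ) * G ((x : X) : OnePoint X) = g x
    rw [h1, h2]; simp

/-- A function in `C₀(X)` extending `g ∈ C(K)`. -/
def extend [LocallyCompactSpace X] [T2Space X] {K : TopologicalSpace.Compacts X}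
    (g : C(K, ℂ)) : C₀(X, ℂ) := (exists_extension K g).choose

theorem extend_apply [LocallyCompactSpace X] [T2Space X] {K : TopologicalSpace.Compacts X}
    (g : C(K, ℂ)) {x : X} (hx : x ∈ K) : extend g x = g ⟨x, hx⟩ :=
  (exists_extension K g).choose_spec ⟨x, hx⟩

variable {E : Type v} [NormedAddCommGroup E] [NormedSpace ℂ E]
  [SMul C₀(X, ℂ) E] [CStarModule C₀(X, ℂ) E] {K : TopologicalSpace.Compacts X}

theorem smul_mem_idealSubmodule {f : C₀(X, ℂ)} (hf : ∀ x ∈ K, f x = 0) (ξ : E) :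
    f • ξ ∈ idealSubmodule E K :=
  Submodule.le_topologicalClosure _ (Submodule.subset_span ⟨f, ξ, hf, rfl⟩)

theorem idealSubmodule_le_comap (f : C₀(X, ℂ)) :
    idealSubmodule E K ≤ (idealSubmodule E K).comap (smulCLM (E := E) f).toLinearMap := by
  refine Submodule.topologicalClosure_minimal _ (Submodule.span_le.2 ?_) ?_
  · rintro _ ⟨g, ξ, hg, rfl⟩
    change f • g • ξ ∈ idealSubmodule E K
    rw [← mul_smul']
    exact smul_mem_idealSubmodule (fun x hx => by simp [hg x hx]) ξ
  · exact (Submodule.isClosed_topologicalClosure _).preimage (smulCLM (E := E) f).continuous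

/-- Elements of `C₀(X)` equal to one on `K` act trivially modulo `E C₀(X \ K)`. -/
theorem sub_smul_mem_idealSubmodule {f : C₀(X, ℂ)} (hf : ∀ x ∈ K, f x = 1) (ξ : E) :
    ξ - f • ξ ∈ idealSubmodule E K := by
  have hcl : IsClosed (idealSubmodule E K : Set E) := Submodule.isClosed_topologicalClosure _
  rw [← SetLike.mem_coe, ← hcl.closure_eq, Metric.mem_closure_iff]
  intro ε hε
  obtain ⟨b, hb⟩ := exists_norm_sub_smul_lt X ξ (ε := ε / (1 + ‖f‖)) (by positivity)
  refine ⟨(b - f * b) • ξ, smul_mem_idealSubmodule (fun x hx => by simp [hf x hx]) ξ, ?_⟩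
  have h1 : ξ - f • ξ - (b - f * b) • ξ = (ξ - b • ξ) - f • (ξ - b • ξ) := by
    have := (smulCLM (E := E) f).map_sub ξ (b • ξ)
    simp only [smulCLM_apply] at this
    rw [this, sub_smul', mul_smul']
    abel
  rw [dist_eq_norm, h1]
  calc _ ≤ ‖ξ - b • ξ‖ + ‖f‖ * ‖ξ - b • ξ‖ :=
        (norm_sub_le _ _).trans (by gcongr; exact norm_smul_le' _ _)
    _ = (1 + ‖f‖) * ‖ξ - b • ξ‖ := by ring
    _ < (1 + ‖f‖) * (ε / (1 + ‖f‖)) := by gcongr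
    _ = ε := by field_simp

/-- The quotient norm on `E_K`. It is equal to the norm given by the inner product
`⟨[ξ], [η]⟩ = ⟨ξ, η⟩|_K`, see `norm_mk`. -/
instance : NormedAddCommGroup (Restriction E K) :=
  haveI : IsClosed (idealSubmodule E K : Set E) := Submodule.isClosed_topologicalClosure _
  inferInstanceAs (NormedAddCommGroup (E ⧸ idealSubmodule E K))

instance : NormedSpace ℂ (Restriction E K) :=
  inferInstanceAs (NormedSpace ℂ (E ⧸ idealSubmodule E K))

/-- The quotient map `E → E_K`. -/
def Restriction.mk (K : TopologicalSpace.Compacts X) : E →ₗ[ℂ] Restriction E K :=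
  (idealSubmodule E K).mkQ

theorem Restriction.mk_surjective : Function.Surjective (Restriction.mk (E := E) K) :=
  Submodule.mkQ_surjective _

theorem Restriction.mk_eq_mk {ξ η : E} :
    Restriction.mk K ξ = Restriction.mk K η ↔ ξ - η ∈ idealSubmodule E K :=
  Submodule.Quotient.eq _

/-! The inner product `⟨[ξ], [η]⟩ = ⟨ξ, η⟩|_K` on `E_K`. -/

/-- The restriction map `C₀(X) → C(K)`. -/
def restrict (K : TopologicalSpace.Compacts X) (f : C₀(X, ℂ)) : C(K, ℂ) :=
  ⟨fun x => f x, f.continuous.comp continuous_subtype_val⟩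

theorem inner_apply_eq_zero {ζ : E} (hζ : ζ ∈ idealSubmodule E K) (ξ : E) {x : X} (hx : x ∈ K) :
    (inner C₀(X, ℂ) ξ ζ : C₀(X, ℂ)) x = 0 := by
  have hev : Continuous fun f : C₀(X, ℂ) => f x := by
    refine LipschitzWith.continuous (K := 1) (LipschitzWith.of_dist_le_mul fun f g => ?_)
    rw [dist_eq_norm, dist_eq_norm, NNReal.coe_one, one_mul]
    exact norm_apply_le (f - g) x
  let φ : E →ₗ[ℂ] ℂ :=
    { toFun := fun ζ => (inner C₀(X, ℂ) ξ ζ : C₀(X, ℂ)) x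
      map_add' := fun a b => by simp
      map_smul' := fun a b => by simp }
  have hφ : Continuous φ :=
    hev.comp (CStarModule.innerSL (A := C₀(X, ℂ)) ξ).continuous
  have hle : idealSubmodule E K ≤ LinearMap.ker φ := by
    refine Submodule.topologicalClosure_minimal _ (Submodule.span_le.2 ?_) ?_
    · rintro _ ⟨g, η, hg, rfl⟩
      simp [φ, hg x hx]
    · exact isClosed_singleton.preimage hφ
  exact hle hζ

theorem restrict_inner_congr {ξ ξ' η η' : E} (h : Restriction.mk K ξ = Restriction.mk K ξ')
    (h' : Restriction.mk K η = Restriction.mk K η') :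
    restrict K (inner C₀(X, ℂ) ξ η) = restrict K (inner C₀(X, ℂ) ξ' η') := by
  rw [Restriction.mk_eq_mk] at h h'
  ext x
  have h1 := inner_apply_eq_zero h' ξ x.2
  have h2 := inner_apply_eq_zero h η' x.2
  rw [CStarModule.inner_sub_right, ZeroAtInftyContinuousMap.sub_apply, sub_eq_zero] at h1 h2
  change (inner C₀(X, ℂ) ξ η : C₀(X, ℂ)) x = (inner C₀(X, ℂ) ξ' η' : C₀(X, ℂ)) x
  rw [h1, ← CStarModule.star_inner η' ξ, ← CStarModule.star_inner η' ξ',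
    ZeroAtInftyContinuousMap.star_apply, ZeroAtInftyContinuousMap.star_apply, h2]

instance : Inner C(K, ℂ) (Restriction E K) where
  inner p q := restrict K (inner C₀(X, ℂ) (Function.surjInv Restriction.mk_surjective p : E)
    (Function.surjInv Restriction.mk_surjective q))

theorem Restriction.inner_mk (ξ η : E) :
    inner C(K, ℂ) (Restriction.mk K ξ) (Restriction.mk K η)
      = restrict K (inner C₀(X, ℂ) ξ η) :=
  restrict_inner_congr (Function.surjInv_eq _ _) (Function.surjInv_eq _ _)

variable [LocallyCompactSpace X] [T2Space X]

/-- `g ∈ C(K)` acts on `E_K` by `g • [ξ] = [f • ξ]`, where `f ∈ C₀(X)` extends `g`. -/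
instance : SMul C(K, ℂ) (Restriction E K) where
  smul g := (idealSubmodule E K).mapQ (idealSubmodule E K)
    (smulCLM (E := E) (extend g)).toLinearMap (idealSubmodule_le_comap _)

/-- The action does not depend on the choice of the extension. -/
theorem Restriction.smul_mk {g : C(K, ℂ)} {f : C₀(X, ℂ)} (hf : ∀ x : K, f x = g x) (ξ : E) :
    g • Restriction.mk K ξ = Restriction.mk K (f • ξ) := by
  change Restriction.mk K (extend g • ξ) = _
  rw [Restriction.mk_eq_mk, ← sub_smul']
  refine smul_mem_idealSubmodule (fun x hx => ?_) ξ
  simp [extend_apply g hx, hf ⟨x, hx⟩]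

instance : Module C(K, ℂ) (Restriction E K) where
  one_smul q := by
    obtain ⟨ξ, rfl⟩ := Restriction.mk_surjective q
    rw [Restriction.smul_mk (f := extend 1) (fun x => extend_apply 1 x.2), eq_comm,
      Restriction.mk_eq_mk]
    exact sub_smul_mem_idealSubmodule (fun x hx => by simp [extend_apply 1 hx]) ξ
  mul_smul g h q := by
    obtain ⟨ξ, rfl⟩ := Restriction.mk_surjective q
    rw [Restriction.smul_mk (f := extend h) (fun x => extend_apply h x.2),
      Restriction.smul_mk (f := extend g) (fun x => extend_apply g x.2), ← mul_smul',
      Restriction.smul_mk (f := extend g * extend h)]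
    intro x
    simp [extend_apply _ x.2]
  smul_zero g := by
    rw [← map_zero (Restriction.mk (E := E) K),
      Restriction.smul_mk (f := extend g) (fun x => extend_apply g x.2)]
    congr 1
    exact (smulCLM (E := E) (extend g)).map_zero
  smul_add g p q := by
    obtain ⟨ξ, rfl⟩ := Restriction.mk_surjective p
    obtain ⟨η, rfl⟩ := Restriction.mk_surjective q
    have h : ∀ ζ : E, g • Restriction.mk K ζ = Restriction.mk K (extend g • ζ) :=
      Restriction.smul_mk fun x => extend_apply g x.2
    rw [← map_add, h, h, h, smul_add', map_add]
  add_smul g h q := by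
    obtain ⟨ξ, rfl⟩ := Restriction.mk_surjective q
    rw [Restriction.smul_mk (f := extend h) (fun x => extend_apply h x.2),
      Restriction.smul_mk (f := extend g) (fun x => extend_apply g x.2), ← map_add, ← add_smul',
      Restriction.smul_mk (f := extend g + extend h)]
    intro x
    simp [extend_apply _ x.2]
  zero_smul q := by
    obtain ⟨ξ, rfl⟩ := Restriction.mk_surjective q
    rw [Restriction.smul_mk (f := 0) (fun x => by simp)]
    have : (0 : C₀(X, ℂ)) • ξ = 0 := by simpa using sub_smul' (0 : C₀(X, ℂ)) 0 ξ
    rw [this, map_zero]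

theorem Restriction.norm_mk (ξ : E) :
    ‖Restriction.mk K ξ‖ = √‖restrict K (inner C₀(X, ℂ) ξ ξ)‖ := by
  have hnorm : ‖Restriction.mk K ξ‖ = Metric.infDist ξ (idealSubmodule E K : Set E) :=
    QuotientAddGroup.norm_mk (S := (idealSubmodule E K).toAddSubgroup) ξ
  refine le_antisymm ?_ (Real.sqrt_le_iff.2 ⟨norm_nonneg _, ?_⟩)
  · refine le_of_forall_pos_le_add fun ε hε => ?_
    set c := √‖restrict K (inner C₀(X, ℂ) ξ ξ)‖ with hc
    have hc0 : 0 ≤ c := Real.sqrt_nonneg _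
    set h : C₀(X, ℂ) := inner C₀(X, ℂ) ξ ξ with hh
    have hopen : IsOpen {x | ‖h x‖ < (c + ε) ^ 2} :=
      isOpen_lt (continuous_norm.comp h.continuous) continuous_const
    have hKU : (K : Set X) ⊆ {x | ‖h x‖ < (c + ε) ^ 2} := fun x hx => by
      have h1 : ‖h x‖ ≤ ‖restrict K h‖ := (restrict K h).norm_coe_le_norm ⟨x, hx⟩
      have h2 : c ^ 2 = ‖restrict K h‖ := Real.sq_sqrt (norm_nonneg _)
      change ‖h x‖ < (c + ε) ^ 2
      nlinarith
    obtain ⟨k, hk1, hk0, hk, hk01⟩ := exists_continuous_one_zero_of_isCompact K.isCompact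
      hopen.isClosed_compl (Set.disjoint_compl_right_iff_subset.2 hKU)
    let f : C₀(X, ℂ) := ⟨⟨fun x => (k x : ℂ), Complex.continuous_ofReal.comp k.continuous⟩,
      HasCompactSupport.is_zero_at_infty
        (hk.comp_left (g := fun t : ℝ => (t : ℂ)) Complex.ofReal_zero)⟩
    have hf : ∀ x, f x = (k x : ℂ) := fun x => rfl
    have h1 : Restriction.mk K ξ = Restriction.mk K (f • ξ) := by
      rw [Restriction.mk_eq_mk]
      refine sub_smul_mem_idealSubmodule (fun x hx => ?_) ξ
      have : k x = 1 := hk1 hx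
      rw [hf, this, Complex.ofReal_one]
    have h2 : ‖f • ξ‖ ^ 2 ≤ (c + ε) ^ 2 := by
      rw [CStarModule.norm_sq_eq C₀(X, ℂ)]
      refine norm_le_of_forall (by positivity) fun x => ?_
      rw [CStarModule.inner_op_smul_right, CStarModule.inner_op_smul_left, ← hh,
        ZeroAtInftyContinuousMap.mul_apply, ZeroAtInftyContinuousMap.mul_apply,
        ZeroAtInftyContinuousMap.star_apply, norm_mul, norm_mul, norm_star, hf,
        Complex.norm_real, Real.norm_of_nonneg (hk01 x).1]
      by_cases hx : x ∈ {x | ‖h x‖ < (c + ε) ^ 2}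
      · have hx' : ‖h x‖ < (c + ε) ^ 2 := hx
        have h3 := (hk01 x).1
        have h4 := (hk01 x).2
        calc k x * (‖h x‖ * k x) ≤ 1 * (‖h x‖ * 1) := by gcongr
          _ ≤ _ := by linarith
      · have : k x = 0 := hk0 hx
        rw [this, zero_mul]
        positivity
    rw [h1]
    calc ‖Restriction.mk K (f • ξ)‖ ≤ ‖f • ξ‖ :=
          Submodule.Quotient.norm_mk_le (idealSubmodule E K) (f • ξ)
      _ ≤ c + ε := le_of_sq_le_sq h2 (by positivity)
  · refine (ContinuousMap.norm_le _ (by positivity)).2 fun x => ?_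
    have h0 : 0 ≤ √‖(inner C₀(X, ℂ) ξ ξ : C₀(X, ℂ)) x‖ := Real.sqrt_nonneg _
    have key : √‖(inner C₀(X, ℂ) ξ ξ : C₀(X, ℂ)) x‖ ≤ ‖Restriction.mk K ξ‖ := by
      rw [hnorm]
      refine (Metric.le_infDist ⟨0, Submodule.zero_mem _⟩).2 fun ζ hζ => ?_
      have h1 : restrict K (inner C₀(X, ℂ) ξ ξ) = restrict K (inner C₀(X, ℂ) (ξ - ζ) (ξ - ζ)) := by
        have : Restriction.mk K ξ = Restriction.mk K (ξ - ζ) := by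
          rw [Restriction.mk_eq_mk]; simpa using hζ
        exact restrict_inner_congr this this
      have h2 : (inner C₀(X, ℂ) ξ ξ : C₀(X, ℂ)) x
          = (inner C₀(X, ℂ) (ξ - ζ) (ξ - ζ) : C₀(X, ℂ)) x := DFunLike.congr_fun h1 x
      rw [h2, dist_eq_norm, CStarModule.norm_eq_sqrt_norm_inner_self (A := C₀(X, ℂ)) (ξ - ζ)]
      exact Real.sqrt_le_sqrt (norm_apply_le _ _)
    calc ‖restrict K (inner C₀(X, ℂ) ξ ξ) x‖ = √‖(inner C₀(X, ℂ) ξ ξ : C₀(X, ℂ)) x‖ ^ 2 :=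
          (Real.sq_sqrt (norm_nonneg _)).symm
      _ ≤ _ := by gcongr

/-- The inner product `C(K)`-module `E_K`; it is complete if `E` is. -/
instance : CStarModule C(K, ℂ) (Restriction E K) where
  inner_add_right {p q r} := by
    obtain ⟨ξ, rfl⟩ := Restriction.mk_surjective p
    obtain ⟨η, rfl⟩ := Restriction.mk_surjective q
    obtain ⟨ζ, rfl⟩ := Restriction.mk_surjective r
    rw [← map_add, Restriction.inner_mk, Restriction.inner_mk, Restriction.inner_mk,
      CStarModule.inner_add_right]
    rfl
  inner_self_nonneg {p} := by
    obtain ⟨ξ, rfl⟩ := Restriction.mk_surjective p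
    rw [Restriction.inner_mk, ContinuousMap.le_def]
    intro x
    exact (CStarModule.inner_self_nonneg (A := C₀(X, ℂ)) (x := ξ) : _) x
  inner_self {p} := by
    obtain ⟨ξ, rfl⟩ := Restriction.mk_surjective p
    rw [Restriction.inner_mk, ← norm_eq_zero (a := Restriction.mk K ξ), Restriction.norm_mk,
      Real.sqrt_eq_zero (norm_nonneg _), norm_eq_zero]
  inner_op_smul_right {g p q} := by
    obtain ⟨ξ, rfl⟩ := Restriction.mk_surjective p
    obtain ⟨η, rfl⟩ := Restriction.mk_surjective q
    rw [Restriction.smul_mk (f := extend g) (fun x => extend_apply g x.2), Restriction.inner_mk,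
      Restriction.inner_mk, CStarModule.inner_op_smul_right]
    ext x
    simp [restrict, extend_apply g x.2]
  inner_smul_right_complex {z p q} := by
    obtain ⟨ξ, rfl⟩ := Restriction.mk_surjective p
    obtain ⟨η, rfl⟩ := Restriction.mk_surjective q
    rw [← map_smul, Restriction.inner_mk, Restriction.inner_mk,
      CStarModule.inner_smul_right_complex]
    rfl
  star_inner p q := by
    obtain ⟨ξ, rfl⟩ := Restriction.mk_surjective p
    obtain ⟨η, rfl⟩ := Restriction.mk_surjective q
    rw [Restriction.inner_mk, Restriction.inner_mk, ← CStarModule.star_inner ξ η]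
    rfl
  norm_eq_sqrt_norm_inner_self p := by
    obtain ⟨ξ, rfl⟩ := Restriction.mk_surjective p
    rw [Restriction.inner_mk, Restriction.norm_mk]

/-- `E` is `σ`-finitely generated: for every compact `K`, the `C(K)`-linear span of some finite
subset of `E_K` is dense in `E_K`. -/
def IsSigmaFinitelyGenerated (X : Type u) [TopologicalSpace X] [LocallyCompactSpace X] [T2Space X]
    (E : Type v) [NormedAddCommGroup E] [NormedSpace ℂ E] [SMul C₀(X, ℂ) E]
    [CStarModule C₀(X, ℂ) E] : Prop :=
  ∀ K : TopologicalSpace.Compacts X, ∃ S : Finset (Restriction E K),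
    Dense (Submodule.span C(K, ℂ) (S : Set (Restriction E K)) : Set (Restriction E K))

/-- `E` is `σ`-projective: for every compact `K`, the `C(K)`-module `E_K` is projective. -/
def IsSigmaProjective (X : Type u) [TopologicalSpace X] [LocallyCompactSpace X] [T2Space X]
    (E : Type v) [NormedAddCommGroup E] [NormedSpace ℂ E] [SMul C₀(X, ℂ) E]
    [CStarModule C₀(X, ℂ) E] : Prop :=
  ∀ K : TopologicalSpace.Compacts X, Module.Projective C(K, ℂ) (Restriction E K)

end Restriction

end HilbertC0
/-! ### Complex vector bundles with metric, and their sections vanishing at infinity -/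

/-- A complex vector bundle over `X`: a family of nonzero complex vector spaces with a topology on
the total space (the first argument `ℂ` of `TotalSpace` is a dummy) that is locally trivial with
finite-dimensional fibres; the rank may vary with the component. -/
structure ComplexVectorBundle (X : Type u) [TopologicalSpace X] where
  /-- The fibres. -/
  Fiber : X → Type w
  [addCommGroup : ∀ x, AddCommGroup (Fiber x)]
  [module : ∀ x, Module ℂ (Fiber x)]
  [topology : TopologicalSpace (TotalSpace ℂ Fiber)]
  nontrivial : ∀ x, Nontrivial (Fiber x)
  locally_trivial : ∀ x, ∃ (n : ℕ) (e : Trivialization (Fin n → ℂ) (π ℂ Fiber)),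
    x ∈ e.baseSet ∧ ∀ y ∈ e.baseSet, IsLinearMap ℂ fun v : Fiber y => (e ⟨y, v⟩).2

namespace ComplexVectorBundle

attribute [instance] addCommGroup module topology

variable {X : Type u} [TopologicalSpace X]

/-- A metric on a complex vector bundle: an inner product on each fibre (conjugate linear in the
first variable) that is continuous on the total space of the Whitney sum `V ⊕ V`. -/
structure Metric (V : ComplexVectorBundle.{u, w} X) where
  /-- The inner product on each fibre. -/
  core : ∀ x, InnerProductSpace.Core ℂ (V.Fiber x)
  continuous_inner : Continuous fun q : TotalSpace (ℂ × ℂ) (V.Fiber ×ᵇ V.Fiber) =>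
    (core q.proj).inner q.2.1 q.2.2

variable {V : ComplexVectorBundle.{u, w} X}

/-- The inner product `β(v, w)` of two vectors in the same fibre. -/
def Metric.form (β : V.Metric) {x : X} (v w : V.Fiber x) : ℂ := (β.core x).inner v w

/-- `s` is a continuous section. -/
def IsContinuousSection (s : ∀ x, V.Fiber x) : Prop :=
  Continuous fun x => (⟨x, s x⟩ : TotalSpace ℂ V.Fiber)

section Continuity

theorem continuousAt_section_iff {n : ℕ} (e : Trivialization (Fin n → ℂ) (π ℂ V.Fiber))
    (s : ∀ x, V.Fiber x) {x : X} (hx : x ∈ e.baseSet) :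
    ContinuousAt (fun y => (⟨y, s y⟩ : TotalSpace ℂ V.Fiber)) x ↔
      ContinuousAt (fun y => (e ⟨y, s y⟩).2) x := by
  have hsrc : ∀ y ∈ e.baseSet, (⟨y, s y⟩ : TotalSpace ℂ V.Fiber) ∈ e.source := fun y hy => by
    rw [e.source_eq]; exact hy
  have hnhds : (fun y => (⟨y, s y⟩ : TotalSpace ℂ V.Fiber)) ⁻¹' e.source ∈ 𝓝 x :=
    mem_of_superset (e.open_baseSet.mem_nhds hx) hsrc
  rw [e.toOpenPartialHomeomorph.continuousAt_iff_continuousAt_comp_left hnhds]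
  constructor
  · intro h
    exact continuousAt_snd.comp h
  · intro h
    refine (continuousAt_id.prodMk h).congr ?_
    filter_upwards [e.open_baseSet.mem_nhds hx] with y hy
    exact Prod.ext (e.proj_toFun _ (hsrc y hy)).symm rfl

theorem isContinuousSection_of_local {s : ∀ x, V.Fiber x}
    (h : ∀ (n : ℕ) (e : Trivialization (Fin n → ℂ) (π ℂ V.Fiber)),
      (∀ y ∈ e.baseSet, IsLinearMap ℂ fun v : V.Fiber y => (e ⟨y, v⟩).2) →
      ∀ x ∈ e.baseSet, ContinuousAt (fun y => (e ⟨y, s y⟩).2) x) : IsContinuousSection s := by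
  refine continuous_iff_continuousAt.2 fun x => ?_
  obtain ⟨n, e, hx, he⟩ := V.locally_trivial x
  exact (continuousAt_section_iff e s hx).2 (h n e he x hx)

theorem IsContinuousSection.add {s t : ∀ x, V.Fiber x} (hs : IsContinuousSection s)
    (ht : IsContinuousSection t) : IsContinuousSection (s + t) := by
  refine isContinuousSection_of_local fun n e he x hx => ?_
  have h1 := (continuousAt_section_iff e s hx).1 hs.continuousAt
  have h2 := (continuousAt_section_iff e t hx).1 ht.continuousAt
  refine (h1.add h2).congr ?_
  filter_upwards [e.open_baseSet.mem_nhds hx] with y hy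
  exact ((he y hy).map_add (s y) (t y)).symm

theorem IsContinuousSection.smul {s : ∀ x, V.Fiber x} (hs : IsContinuousSection s)
    {f : X → ℂ} (hf : Continuous f) : IsContinuousSection fun x => f x • s x := by
  refine isContinuousSection_of_local fun n e he x hx => ?_
  have h1 := (continuousAt_section_iff e s hx).1 hs.continuousAt
  refine (hf.continuousAt.smul h1).congr ?_
  filter_upwards [e.open_baseSet.mem_nhds hx] with y hy
  exact ((he y hy).map_smul (f y) (s y)).symm

theorem isContinuousSection_zero : IsContinuousSection (0 : ∀ x, V.Fiber x) := by
  refine isContinuousSection_of_local fun n e he x hx => ?_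
  refine (continuousAt_const (y := (0 : Fin n → ℂ))).congr ?_
  filter_upwards [e.open_baseSet.mem_nhds hx] with y hy
  exact ((he y hy).map_zero).symm

theorem IsContinuousSection.form {β : V.Metric} {s t : ∀ x, V.Fiber x}
    (hs : IsContinuousSection s) (ht : IsContinuousSection t) :
    Continuous fun x => β.form (s x) (t x) := by
  have h : Continuous fun x =>
      (⟨x, (s x, t x)⟩ : TotalSpace (ℂ × ℂ) (V.Fiber ×ᵇ V.Fiber)) :=
    (FiberBundle.Prod.isInducing_diag ℂ V.Fiber ℂ V.Fiber).continuous_iff.2 (hs.prodMk ht)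
  exact β.continuous_inner.comp h

end Continuity

namespace Metric

variable (β : V.Metric) {x : X}

theorem form_add_right (a b c : V.Fiber x) : β.form a (b + c) = β.form a b + β.form a c := by
  let _ := β.core x
  exact InnerProductSpace.Core.inner_add_right a b c

theorem form_smul_right (a b : V.Fiber x) (r : ℂ) : β.form a (r • b) = r * β.form a b := by
  let _ := β.core x
  exact InnerProductSpace.Core.inner_smul_right a b

theorem form_conj (a b : V.Fiber x) : star (β.form a b) = β.form b a :=
  (β.core x).conj_inner_symm b a

theorem form_add_left (a b c : V.Fiber x) : β.form (a + b) c = β.form a c + β.form b c :=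
  (β.core x).add_left a b c

theorem form_smul_left (a b : V.Fiber x) (r : ℂ) : β.form (r • a) b = star r * β.form a b :=
  (β.core x).smul_left a b r

theorem form_self_nonneg (a : V.Fiber x) : 0 ≤ β.form a a := by
  have h1 : β.form a a = star (β.form a a) := (β.form_conj a a).symm
  have h2 : 0 ≤ (β.form a a).re := (β.core x).re_inner_nonneg a
  have h3 : (β.form a a).im = 0 := Complex.conj_eq_iff_im.1 h1.symm
  exact Complex.le_def.2 ⟨h2, h3.symm⟩

theorem form_self_eq_zero {a : V.Fiber x} : β.form a a = 0 ↔ a = 0 := by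
  refine ⟨(β.core x).definite a, ?_⟩
  rintro rfl
  have := β.form_smul_right (0 : V.Fiber x) 0 0
  simpa using this

theorem norm_form_sq_le (a b : V.Fiber x) :
    ‖β.form a b‖ ^ 2 ≤ ‖β.form a a‖ * ‖β.form b b‖ := by
  let _ := β.core x
  have h := InnerProductSpace.Core.inner_mul_inner_self_le (𝕜 := ℂ) a b
  have h1 : ‖β.form b a‖ = ‖β.form a b‖ := by rw [← β.form_conj a b, norm_star]
  calc ‖β.form a b‖ ^ 2 = ‖β.form a b‖ * ‖β.form b a‖ := by rw [h1]; ring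
    _ ≤ (β.form a a).re * (β.form b b).re := h
    _ ≤ _ := by
      have h2 : 0 ≤ (β.form b b).re := (β.core x).re_inner_nonneg b
      gcongr
      · exact Complex.re_le_norm _
      · exact Complex.re_le_norm _

end Metric

theorem tendsto_form_zero (β : V.Metric) {s t : ∀ x, V.Fiber x}
    (hs : Tendsto (fun x => β.form (s x) (s x)) (cocompact X) (𝓝 0))
    (ht : Tendsto (fun x => β.form (t x) (t x)) (cocompact X) (𝓝 0)) :
    Tendsto (fun x => β.form (s x) (t x)) (cocompact X) (𝓝 0) := by
  have h : Tendsto (fun x => √(‖β.form (s x) (s x)‖ * ‖β.form (t x) (t x)‖))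
      (cocompact X) (𝓝 0) := by
    have := (Real.continuous_sqrt.tendsto _).comp (hs.norm.mul ht.norm)
    simpa [Function.comp_def] using this
  exact squeeze_zero_norm (fun x => Real.le_sqrt_of_sq_le (β.norm_form_sq_le _ _)) h

/-- The space `Γ₀(V)` of continuous sections `s` of `V` vanishing at infinity, that is, such that
`β(s(x), s(x)) → 0` as `x → ∞`. -/
def sectionsC0 (V : ComplexVectorBundle.{u, w} X) (β : V.Metric) :
    Submodule ℂ (∀ x, V.Fiber x) where
  carrier := {s | IsContinuousSection s ∧
    Tendsto (fun x => β.form (s x) (s x)) (cocompact X) (𝓝 0)}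
  zero_mem' := ⟨isContinuousSection_zero, by
    simp only [Pi.zero_apply, β.form_self_eq_zero.2]
    exact tendsto_const_nhds⟩
  add_mem' := by
    rintro s t ⟨hs, hs0⟩ ⟨ht, ht0⟩
    refine ⟨hs.add ht, ?_⟩
    have hst := tendsto_form_zero β hs0 ht0
    have hts := tendsto_form_zero β ht0 hs0
    have := (hs0.add hst).add (hts.add ht0)
    simp only [add_zero] at this
    refine this.congr fun x => ?_
    rw [Pi.add_apply, β.form_add_left, β.form_add_right, β.form_add_right]
  smul_mem' := by
    rintro c s ⟨hs, hs0⟩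
    refine ⟨hs.smul continuous_const, ?_⟩
    have := hs0.const_mul (star c * c)
    rw [mul_zero] at this
    refine this.congr fun x => ?_
    rw [Pi.smul_apply, β.form_smul_left, β.form_smul_right, mul_assoc]

variable {β : V.Metric}

/-- The action `(f • s)(x) = f(x) s(x)` of `C₀(X)` on `Γ₀(V)`. -/
instance : SMul C₀(X, ℂ) (V.sectionsC0 β) where
  smul f s := ⟨fun x => f x • (s : ∀ x, V.Fiber x) x, s.2.1.smul f.continuous, by
    have h := ((zero_at_infty f).star.mul (zero_at_infty f)).mul s.2.2
    simp only [star_zero, mul_zero] at h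
    refine h.congr fun x => ?_
    rw [β.form_smul_left, β.form_smul_right, mul_assoc]⟩

theorem smul_apply (f : C₀(X, ℂ)) (s : V.sectionsC0 β) (x : X) :
    (f • s : V.sectionsC0 β).1 x = f x • s.1 x := rfl

/-- The inner product `⟨s, t⟩(x) = β(s(x), t(x))` on `Γ₀(V)`. -/
instance : Inner C₀(X, ℂ) (V.sectionsC0 β) where
  inner s t := ⟨⟨fun x => β.form (s.1 x) (t.1 x), s.2.1.form t.2.1⟩,
    tendsto_form_zero β s.2.2 t.2.2⟩

theorem inner_apply (s t : V.sectionsC0 β) (x : X) :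
    (inner C₀(X, ℂ) s t : C₀(X, ℂ)) x = β.form (s.1 x) (t.1 x) := rfl

/-- The norm on `Γ₀(V)` given by the inner product. -/
instance instNormSections : Norm (V.sectionsC0 β) := CStarModule.norm C₀(X, ℂ)

instance instCStarModuleSections : CStarModule C₀(X, ℂ) (V.sectionsC0 β) where
  inner_add_right {s t r} := by ext x; exact β.form_add_right _ _ _
  inner_self_nonneg {s} := fun x => β.form_self_nonneg _
  inner_self {s} := by
    constructor
    · intro h
      ext x
      exact β.form_self_eq_zero.1 (DFunLike.congr_fun h x)
    · rintro rfl
      ext x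
      exact β.form_self_eq_zero.2 rfl
  inner_op_smul_right {f s t} := by ext x; exact β.form_smul_right _ _ _
  inner_smul_right_complex {z s t} := by ext x; exact β.form_smul_right _ _ _
  star_inner s t := by ext x; exact β.form_conj _ _
  norm_eq_sqrt_norm_inner_self s := rfl

instance : NormedAddCommGroup (V.sectionsC0 β) :=
  NormedAddCommGroup.ofCore (CStarModule.normedSpaceCore C₀(X, ℂ))

instance : NormedSpace ℂ (V.sectionsC0 β) :=
  NormedSpace.ofCore (CStarModule.normedSpaceCore C₀(X, ℂ))

end ComplexVectorBundle

end

noncomputable section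

/-! From module to bundle: the fibre at `x` is `E` modulo the null space of the form `⟨ξ, η⟩(x)`,
and `ξ` becomes the section `x ↦ evalAt x ξ`. Fullness makes every fibre nonzero. The crux is that
the rank is locally constant. Density of a finitely generated submodule does not give this: the
functions on `[0, 1]` vanishing at `0` are topologically generated by one element, and their fibre
at `0` is zero. Projectivity closes the gap. By the factorization `exists_eq_smul`, the value at a
point of a `C(K)`-linear functional on `E_K` depends only on the value of its argument there, so a
functional that vanishes on topological generators is zero. Hence a splitting of `E_K` off a free
module involves only finitely many basis vectors (`Restriction.finite_of_projective`), and `E_K` is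
algebraically finitely generated. A Nakayama argument (`exists_isFrameOn`) then spreads a basis of
one fibre to the fibres nearby. These frames trivialize the bundle, inverse Gram matrices turning
inner products into coefficients. The map from `E` to sections is isometric, so its range is closed;
a partition of unity shows that the range is dense.

From bundle to module: over a compact set finitely many trivializations suffice, and cutting off
their coordinates and frames by square roots of a partition of unity gives a finite dual basis
(`exists_dual_basis`), hence finite generation and projectivity. For completeness, a Cauchy sequence
converges in each finite-dimensional fibre. Its inner products with a fixed section converge in
`C₀(X)`, and this is enough to make the limit continuous (`isContinuousSection_of_form`). -/

/-! ### The fibres of a Hilbert `C₀(X)`-module -/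

/-- A compactly supported real function as an element of `C₀(X)`. -/
def ContinuousMap.toC0 {X : Type u} [TopologicalSpace X] (ρ : C(X, ℝ))
    (hρ : HasCompactSupport ρ) : C₀(X, ℂ) :=
  ⟨⟨fun x => (ρ x : ℂ), Complex.continuous_ofReal.comp ρ.continuous⟩,
    HasCompactSupport.is_zero_at_infty
      (hρ.comp_left (g := fun t : ℝ => (t : ℂ)) Complex.ofReal_zero)⟩

namespace HilbertC0

section Fiber

variable {X : Type u} [TopologicalSpace X] {E : Type v} [NormedAddCommGroup E] [NormedSpace ℂ E]
  [SMul C₀(X, ℂ) E] [CStarModule C₀(X, ℂ) E]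

/-- The space `E` with the semi-inner product `⟨ξ, η⟩(x)`. -/
def PreFiber {X : Type u} [TopologicalSpace X] (E : Type v) [NormedAddCommGroup E]
    [NormedSpace ℂ E] [SMul C₀(X, ℂ) E] [CStarModule C₀(X, ℂ) E] (_x : X) : Type v := E

instance (x : X) : AddCommGroup (PreFiber E x) := inferInstanceAs (AddCommGroup E)

instance (x : X) : Module ℂ (PreFiber E x) := inferInstanceAs (Module ℂ E)

variable (E) in
/-- The semi-inner product `⟨ξ, η⟩(x)` on `E`. -/
@[reducible] def preFiberCore (x : X) : PreInnerProductSpace.Core ℂ (PreFiber E x) where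
  inner ξ η := (inner C₀(X, ℂ) (show E from ξ) (show E from η) : C₀(X, ℂ)) x
  conj_inner_symm ξ η := by
    rw [← CStarModule.star_inner (A := C₀(X, ℂ)) (show E from η) (show E from ξ)]
    rfl
  re_inner_nonneg ξ :=
    (Complex.le_def.1 ((CStarModule.inner_self_nonneg (A := C₀(X, ℂ)) (x := (show E from ξ)) :) x)).1
  add_left ξ η ζ := DFunLike.congr_fun
    (CStarModule.inner_add_left (A := C₀(X, ℂ)) (x := (show E from ξ)) (y := (show E from η))
      (z := (show E from ζ))) x
  smul_left ξ η r := DFunLike.congr_fun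
    (CStarModule.inner_smul_left_complex (A := C₀(X, ℂ)) (z := r) (x := (show E from ξ))
      (y := (show E from η))) x

instance (x : X) : SeminormedAddCommGroup (PreFiber E x) :=
  @InnerProductSpace.Core.toSeminormedAddCommGroup ℂ _ _ _ _ (preFiberCore E x)

instance (x : X) : InnerProductSpace ℂ (PreFiber E x) :=
  InnerProductSpace.ofCore (preFiberCore E x)

variable (E) in
/-- The fibre of `E` at `x`: the Hausdorff inner product space associated with `⟨ξ, η⟩(x)`. -/
abbrev Fiber (x : X) : Type v := SeparationQuotient (PreFiber E x)

/-- The value of `ξ ∈ E` at `x`. -/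
def evalAt (x : X) : E →ₗ[ℂ] Fiber E x where
  toFun ξ := SeparationQuotient.mk (X := PreFiber E x) ξ
  map_add' _ _ := rfl
  map_smul' _ _ := rfl

theorem evalAt_surjective (x : X) : Function.Surjective (evalAt (E := E) x) :=
  SeparationQuotient.surjective_mk (X := PreFiber E x)

theorem inner_evalAt (x : X) (ξ η : E) :
    inner ℂ (evalAt x ξ) (evalAt x η) = (inner C₀(X, ℂ) ξ η : C₀(X, ℂ)) x := rfl

theorem norm_evalAt_sq (x : X) (ξ : E) :
    ‖evalAt x ξ‖ ^ 2 = ‖(inner C₀(X, ℂ) ξ ξ : C₀(X, ℂ)) x‖ := by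
  rw [← inner_evalAt, inner_self_eq_norm_sq_to_K, norm_pow]
  simp

theorem norm_evalAt_le (x : X) (ξ : E) : ‖evalAt x ξ‖ ≤ ‖ξ‖ := by
  refine le_of_sq_le_sq ?_ (norm_nonneg _)
  rw [norm_evalAt_sq, CStarModule.norm_sq_eq C₀(X, ℂ)]
  exact norm_apply_le _ _

theorem continuous_norm_evalAt (ξ : E) : Continuous fun x : X => ‖evalAt x ξ‖ := by
  have h : (fun x : X => ‖evalAt x ξ‖) = fun x => √‖(inner C₀(X, ℂ) ξ ξ : C₀(X, ℂ)) x‖ := by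
    ext x
    rw [← norm_evalAt_sq, Real.sqrt_sq (norm_nonneg _)]
  rw [h]
  fun_prop

theorem norm_le_of_forall_evalAt {ξ : E} {c : ℝ} (hc : 0 ≤ c)
    (h : ∀ x : X, ‖evalAt x ξ‖ ≤ c) : ‖ξ‖ ≤ c := by
  refine le_of_sq_le_sq ?_ hc
  rw [CStarModule.norm_sq_eq C₀(X, ℂ)]
  refine norm_le_of_forall (by positivity) fun x => ?_
  rw [← norm_evalAt_sq]
  exact pow_le_pow_left₀ (norm_nonneg _) (h x) 2

theorem evalAt_smul (x : X) (f : C₀(X, ℂ)) (ξ : E) : evalAt x (f • ξ) = f x • evalAt x ξ := by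
  refine ext_inner_left ℂ fun v => ?_
  obtain ⟨η, rfl⟩ := evalAt_surjective x v
  rw [inner_evalAt, CStarModule.inner_op_smul_right, inner_smul_right, inner_evalAt]
  rfl

theorem evalAt_eq_zero_of_mem_idealSubmodule {K : TopologicalSpace.Compacts X} {ζ : E}
    (hζ : ζ ∈ idealSubmodule E K) {x : X} (hx : x ∈ K) : evalAt x ζ = 0 := by
  rw [← inner_self_eq_zero (𝕜 := ℂ), inner_evalAt]
  exact inner_apply_eq_zero hζ ζ hx

/-- If the fibre at `x` were zero, all inner products would vanish at `x`, and so would every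
function in their closed span; but a bump function equal to 1 at `x` lies in that closure. -/
theorem IsFull.nontrivial_fiber [LocallyCompactSpace X] [T2Space X] (h : IsFull X E) (x : X) :
    Nontrivial (Fiber E x) := by
  by_contra hnt
  rw [not_nontrivial_iff_subsingleton] at hnt
  obtain ⟨k, hk1, -, hk, -⟩ := exists_continuous_one_zero_of_isCompact
    (isCompact_singleton (x := x)) isClosed_empty (Set.disjoint_empty _)
  let f : C₀(X, ℂ) := k.toC0 hk
  have hfx : f x = 1 := by
    change ((k x : ℝ) : ℂ) = 1
    rw [hk1 rfl]
    simp
  have hf : f ∈ closure (Submodule.span ℂ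
      (Set.range fun p : E × E => inner C₀(X, ℂ) p.1 p.2) : Set C₀(X, ℂ)) := by
    rw [h]; trivial
  obtain ⟨g, hg, hfg⟩ := Metric.mem_closure_iff.1 hf 1 one_pos
  have hgx : g x = 0 := by
    refine Submodule.span_induction (p := fun (g : C₀(X, ℂ)) _ => g x = 0) ?_ rfl ?_ ?_ hg
    · rintro _ ⟨p, rfl⟩
      change (inner C₀(X, ℂ) p.1 p.2 : C₀(X, ℂ)) x = 0
      rw [← inner_evalAt, Subsingleton.elim (evalAt x p.1) 0, inner_zero_left]
    · intro a b _ _ ha hb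
      simp [ha, hb]
    · intro c a _ ha
      simp [ha]
  have h1 := norm_apply_le (f - g) x
  rw [dist_eq_norm] at hfg
  rw [ZeroAtInftyContinuousMap.sub_apply, hfx, hgx, sub_zero, norm_one] at h1
  linarith

end Fiber

/-! ### Factorization of elements as a function times an element -/

section Factorization

variable {X : Type u} [TopologicalSpace X] {E : Type v} [NormedAddCommGroup E] [NormedSpace ℂ E]
  [SMul C₀(X, ℂ) E] [CStarModule C₀(X, ℂ) E]

/-- The function `φ(‖ξ(x)‖)` in `C₀(X)`, for a continuous function `φ` with `φ(0) = 0`. -/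
def normComp (ξ : E) (φ : ℝ → ℝ) (hφ : Continuous φ) (h0 : φ 0 = 0) : C₀(X, ℂ) where
  toFun x := (φ ‖evalAt x ξ‖ : ℂ)
  continuous_toFun := Complex.continuous_ofReal.comp (hφ.comp (continuous_norm_evalAt ξ))
  zero_at_infty' := by
    have h1 : Tendsto (fun x : X => ‖evalAt x ξ‖) (cocompact X) (𝓝 0) := by
      have h := (Real.continuous_sqrt.tendsto _).comp
        (zero_at_infty (inner C₀(X, ℂ) ξ ξ : C₀(X, ℂ))).norm
      rw [norm_zero, Real.sqrt_zero] at h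
      refine h.congr fun x => ?_
      rw [Function.comp_apply, ← norm_evalAt_sq, Real.sqrt_sq (norm_nonneg _)]
    have h2 := ((Complex.continuous_ofReal.comp hφ).tendsto 0).comp h1
    simp only [Function.comp_apply, h0, Complex.ofReal_zero] at h2
    exact h2

theorem normComp_apply (ξ : E) {φ : ℝ → ℝ} (hφ : Continuous φ) (h0 : φ 0 = 0) (x : X) :
    normComp ξ φ hφ h0 x = (φ ‖evalAt x ξ‖ : ℂ) := rfl

/-- With `r = ‖ξ(x)‖` this is the estimate, uniform in `x`, that makes the regularized quotients of
`ξ` by `√‖ξ(x)‖` a Cauchy sequence. The error is `√r δ / (r + δ)`, and `√r √δ ≤ r + δ`. -/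
theorem abs_sqrt_div_mul_sub_le {r δ : ℝ} (hr : 0 ≤ r) (hδ : 0 < δ) :
    |√r / (r + δ) * r - √r| ≤ √δ := by
  have h1 : √r / (r + δ) * r - √r = -(√r * δ / (r + δ)) := by field_simp; ring
  rw [h1, abs_neg, abs_of_nonneg (by positivity), div_le_iff₀ (by positivity)]
  have h2 := Real.sq_sqrt hr
  have h3 := Real.sq_sqrt hδ.le
  have h4 : 0 < √δ := Real.sqrt_pos.2 hδ
  have h5 : √r * √δ ≤ r + δ := by nlinarith [sq_nonneg (√r - √δ), Real.sqrt_nonneg r]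
  calc √r * δ = √δ * (√r * √δ) := by linear_combination -√r * h3
    _ ≤ √δ * (r + δ) := by gcongr

/-- Multiplying the regularized quotient back by `√r` recovers `r` up to `r δ / (r + δ)`, which
gives `f • η = ξ` in the limit. -/
theorem abs_sqrt_mul_div_mul_sub_le {r δ : ℝ} (hr : 0 ≤ r) (hδ : 0 < δ) :
    |√r * (√r / (r + δ)) * r - r| ≤ δ := by
  have h1 : √r * (√r / (r + δ)) * r - r = -(r * δ / (r + δ)) := by
    rw [mul_div_assoc', Real.mul_self_sqrt hr]
    field_simp
    ring
  rw [h1, abs_neg, abs_of_nonneg (by positivity), div_le_iff₀ (by positivity)]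
  nlinarith

/-- Every `ξ ∈ E` factors as `f • η`, where `f` vanishes at the zeros of `ξ`. -/
theorem exists_eq_smul [CompleteSpace E] (ξ : E) :
    ∃ (f : C₀(X, ℂ)) (η : E), (∀ x, evalAt x ξ = 0 → f x = 0) ∧ ξ = f • η := by
  -- Formally `f = √‖ξ(x)‖` and `η = ξ / √‖ξ(x)‖`; the quotient is the limit of `g n • ξ`, where `g
  -- n` has the denominator `‖ξ(x)‖ + δ n` and so lies in `C₀(X)`.
  let δ : ℕ → ℝ := fun n => 1 / ((n : ℝ) + 1)
  have hδ : ∀ n, 0 < δ n := fun n => by positivity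
  -- The absolute value keeps the denominator positive on all of `ℝ`, since `normComp` takes a
  -- function continuous on the whole line.
  have hcont : ∀ n : ℕ, Continuous fun r : ℝ => √r / (|r| + δ n) := fun n =>
    Real.continuous_sqrt.div (by fun_prop) fun r =>
      (add_pos_of_nonneg_of_pos (abs_nonneg r) (hδ n)).ne'
  let g : ℕ → C₀(X, ℂ) := fun n => normComp ξ _ (hcont n) (by simp)
  let f : C₀(X, ℂ) := normComp ξ _ Real.continuous_sqrt Real.sqrt_zero
  have hg : ∀ n x, g n x = ((√‖evalAt x ξ‖ / (‖evalAt x ξ‖ + δ n) : ℝ) : ℂ) := fun n x => by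
    rw [normComp_apply, abs_norm]
  have hf : ∀ x, f x = ((√‖evalAt x ξ‖ : ℝ) : ℂ) := fun x => rfl
  have hb : ∀ n m (x : X), |√‖evalAt x ξ‖ / (‖evalAt x ξ‖ + δ n) -
      √‖evalAt x ξ‖ / (‖evalAt x ξ‖ + δ m)| * ‖evalAt x ξ‖ ≤ √(δ n) + √(δ m) := fun n m x => by
    have h1 := abs_sqrt_div_mul_sub_le (norm_nonneg (evalAt x ξ)) (hδ n)
    have h2 := abs_sqrt_div_mul_sub_le (norm_nonneg (evalAt x ξ)) (hδ m)
    rw [← abs_of_nonneg (norm_nonneg (evalAt x ξ)), ← abs_mul, abs_norm, sub_mul]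
    rw [abs_le] at *
    constructor <;> linarith [h1.1, h1.2, h2.1, h2.2]
  have hdiff : ∀ n m, ‖g n • ξ - g m • ξ‖ ≤ √(δ n) + √(δ m) := fun n m => by
    refine norm_le_of_forall_evalAt (X := X) (by positivity) fun x => ?_
    rw [← sub_smul', evalAt_smul, norm_smul, ZeroAtInftyContinuousMap.sub_apply, hg, hg,
      ← Complex.ofReal_sub, Complex.norm_real, Real.norm_eq_abs]
    exact hb n m x
  have hδ0 : Tendsto δ atTop (𝓝 0) := tendsto_one_div_add_atTop_nhds_zero_nat
  have hcau : CauchySeq fun n => g n • ξ := by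
    refine cauchySeq_of_le_tendsto_0' (fun n => √(δ n) + √(δ n)) (fun n m hnm => ?_) ?_
    · rw [dist_eq_norm]
      refine (hdiff n m).trans (add_le_add_right (Real.sqrt_le_sqrt ?_) _)
      exact one_div_le_one_div_of_le (by positivity) (by gcongr)
    · simpa using hδ0.sqrt.add hδ0.sqrt
  obtain ⟨η, hη⟩ := cauchySeq_tendsto_of_complete hcau
  refine ⟨f, η, fun x hx => by rw [hf, hx]; simp, ?_⟩
  have h1 : Tendsto (fun n => f • g n • ξ) atTop (𝓝 (f • η)) :=
    ((smulCLM (E := E) f).continuous.tendsto η).comp hη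
  refine tendsto_nhds_unique ?_ h1
  rw [tendsto_iff_norm_sub_tendsto_zero]
  refine squeeze_zero (fun _ => norm_nonneg _) (fun n => ?_) hδ0
  refine norm_le_of_forall_evalAt (X := X) (hδ n).le fun x => ?_
  have h2 : evalAt x (f • g n • ξ - ξ) = (f x * g n x - 1) • evalAt x ξ := by
    rw [map_sub, evalAt_smul, evalAt_smul, sub_smul, mul_smul, one_smul]
  rw [h2, norm_smul, hf, hg, ← Complex.ofReal_mul, ← Complex.ofReal_one, ← Complex.ofReal_sub,
    Complex.norm_real, Real.norm_eq_abs, ← abs_of_nonneg (norm_nonneg (evalAt x ξ)), ← abs_mul,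
    abs_norm, sub_mul, one_mul]
  exact abs_sqrt_mul_div_mul_sub_le (norm_nonneg _) (hδ n)

end Factorization

end HilbertC0

/-! ### Algebraic generation over compact sets and local frames -/

namespace HilbertC0

section LocalFrame

/-- The linear algebra of Nakayama's lemma: applying `(1 - A)⁻¹` to the family `(1 - A) v`, which
lies in `W`, returns `v`. -/
theorem mem_of_sub_mulVec_mem {ι V : Type*} [Fintype ι] [DecidableEq ι] [AddCommGroup V]
    [Module ℂ V] {W : Submodule ℂ V} {A : Matrix ι ι ℂ} (hA : (1 - A).det ≠ 0) {v : ι → V}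
    (h : ∀ i, v i - ∑ j, A i j • v j ∈ W) (i : ι) : v i ∈ W := by
  have h1 : ∀ i, ∑ j, (1 - A) i j • v j ∈ W := fun i => by
    simpa [sub_smul, Finset.sum_sub_distrib, Matrix.one_apply] using h i
  have h2 : v i = ∑ j, (1 - A)⁻¹ i j • ∑ k, (1 - A) j k • v k := by
    simp_rw [Finset.smul_sum, smul_smul]
    rw [Finset.sum_comm]
    simp_rw [← Finset.sum_smul, ← Matrix.mul_apply]
    rw [Matrix.nonsing_inv_mul _ (isUnit_iff_ne_zero.2 hA)]
    simp [Matrix.one_apply]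
  rw [h2]
  exact Submodule.sum_mem _ fun j _ => Submodule.smul_mem _ _ (h1 j)

variable {X : Type u} [TopologicalSpace X] {E : Type v} [NormedAddCommGroup E] [NormedSpace ℂ E]
  [SMul C₀(X, ℂ) E] [CStarModule C₀(X, ℂ) E] {K : TopologicalSpace.Compacts X}

/-- The Gram matrix of the values at `y` of elements of `E`. -/
def gramAt {n : ℕ} (m : Fin n → E) (y : X) : Matrix (Fin n) (Fin n) ℂ :=
  Matrix.of fun i j => (inner C₀(X, ℂ) (m i) (m j) : C₀(X, ℂ)) y

theorem gramAt_eq {n : ℕ} (m : Fin n → E) (y : X) :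
    gramAt m y = Matrix.gram ℂ fun i => evalAt y (m i) := rfl

theorem continuous_gramAt {n : ℕ} (m : Fin n → E) : Continuous (gramAt (X := X) m) :=
  continuous_matrix fun i j => (inner C₀(X, ℂ) (m i) (m j) : C₀(X, ℂ)).continuous

/-- A frame of `E` over `U`: elements whose values are a basis of every fibre over `U`. -/
structure IsFrameOn {n : ℕ} (m : Fin n → E) (U : Set X) : Prop where
  isOpen : IsOpen U
  det_ne_zero : ∀ y ∈ U, (gramAt m y).det ≠ 0
  span_eq_top : ∀ y ∈ U, Submodule.span ℂ (Set.range fun i => evalAt y (m i)) = ⊤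

/-- The evaluation of elements of `E_K` at a point of `K`. -/
def Restriction.evalAt (x : K) : Restriction E K →ₗ[ℂ] Fiber E (x : X) :=
  (idealSubmodule E K).liftQ (HilbertC0.evalAt (x : X)) fun _ hζ =>
    evalAt_eq_zero_of_mem_idealSubmodule hζ x.2

@[simp] theorem Restriction.evalAt_mk (x : K) (ξ : E) :
    Restriction.evalAt x (Restriction.mk K ξ) = HilbertC0.evalAt (x : X) ξ := rfl

theorem Restriction.evalAt_surjective (x : K) :
    Function.Surjective (Restriction.evalAt (E := E) x) := fun v => by
  obtain ⟨ξ, rfl⟩ := HilbertC0.evalAt_surjective (x : X) v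
  exact ⟨Restriction.mk K ξ, rfl⟩

variable [LocallyCompactSpace X] [T2Space X]

theorem Restriction.evalAt_smul (x : K) (g : C(K, ℂ)) (q : Restriction E K) :
    Restriction.evalAt x (g • q) = g x • Restriction.evalAt x q := by
  obtain ⟨ξ, rfl⟩ := Restriction.mk_surjective q
  rw [Restriction.smul_mk (f := extend g) (fun x => extend_apply g x.2), evalAt_mk, evalAt_mk,
    HilbertC0.evalAt_smul, extend_apply g x.2]

theorem Restriction.norm_evalAt_le (x : K) (q : Restriction E K) :
    ‖Restriction.evalAt x q‖ ≤ ‖q‖ := by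
  obtain ⟨ξ, rfl⟩ := Restriction.mk_surjective q
  rw [evalAt_mk, norm_mk]
  refine Real.le_sqrt_of_sq_le ?_
  rw [norm_evalAt_sq]
  exact (restrict K (inner C₀(X, ℂ) ξ ξ)).norm_coe_le_norm x

/-- Evaluation is contractive and onto the fibre, so the values of the generators span a dense
subspace. This subspace is finite-dimensional, hence closed, hence everything. -/
theorem Restriction.span_evalAt_image_eq_top {S : Set (Restriction E K)} (hfin : S.Finite)
    (hS : Dense (Submodule.span C(K, ℂ) S : Set (Restriction E K))) (x : K) :
    Submodule.span ℂ (Restriction.evalAt x '' S) = ⊤ := by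
  have hfd : FiniteDimensional ℂ (Submodule.span ℂ (Restriction.evalAt x '' S)) :=
    FiniteDimensional.span_of_finite ℂ (hfin.image _)
  have hcl := Submodule.closed_of_finiteDimensional (Submodule.span ℂ (Restriction.evalAt x '' S))
  have hmem : ∀ q ∈ Submodule.span C(K, ℂ) S,
      Restriction.evalAt x q ∈ Submodule.span ℂ (Restriction.evalAt x '' S) := fun q hq => by
    induction hq using Submodule.span_induction with
    | mem q hq => exact Submodule.subset_span ⟨q, hq, rfl⟩
    | zero => rw [map_zero]; exact Submodule.zero_mem _
    | add p q _ _ hp hq => rw [map_add]; exact Submodule.add_mem _ hp hq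
    | smul g q _ hq => rw [evalAt_smul]; exact Submodule.smul_mem _ _ hq
  refine eq_top_iff.2 fun v _ => ?_
  obtain ⟨q, rfl⟩ := Restriction.evalAt_surjective x v
  rw [← SetLike.mem_coe, ← hcl.closure_eq, Metric.mem_closure_iff]
  intro ε hε
  obtain ⟨p, hp, hqp⟩ := Metric.mem_closure_iff.1 (hS q) ε hε
  refine ⟨_, hmem p hp, ?_⟩
  rw [dist_eq_norm] at hqp ⊢
  rw [← map_sub]
  exact (norm_evalAt_le x _).trans_lt hqp

variable [CompleteSpace E]

/-- No continuity of `φ` is needed: a representative factors as `f • η` with `f x = 0`, and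
linearity moves `f` out of `φ`. -/
theorem Restriction.apply_eq_zero_of_evalAt_eq_zero (φ : Restriction E K →ₗ[C(K, ℂ)] C(K, ℂ))
    {x : K} {q : Restriction E K} (hq : Restriction.evalAt x q = 0) : φ q x = 0 := by
  obtain ⟨ξ, rfl⟩ := Restriction.mk_surjective q
  obtain ⟨f, η, hf, rfl⟩ := exists_eq_smul (X := X) ξ
  rw [← Restriction.smul_mk (g := restrict K f) (fun _ => rfl), map_smul, smul_eq_mul,
    ContinuousMap.mul_apply]
  have : restrict K f x = 0 := hf x hq
  rw [this, zero_mul]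

/-- Since `φ q x` depends only on the value of `q` at `x`, and the values of `S` span the fibre,
vanishing on `S` is enough. -/
theorem Restriction.eq_zero_of_forall_mem {S : Set (Restriction E K)} (hfin : S.Finite)
    (hS : Dense (Submodule.span C(K, ℂ) S : Set (Restriction E K)))
    (φ : Restriction E K →ₗ[C(K, ℂ)] C(K, ℂ)) (hφ : ∀ q ∈ S, φ q = 0) : φ = 0 := by
  ext q x
  change φ q x = 0
  -- The induction runs over vectors of the fibre, with the claim made for all their lifts, so that
  -- any convenient lift can be subtracted.
  have key : ∀ v ∈ Submodule.span ℂ (Restriction.evalAt x '' S),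
      ∀ q, Restriction.evalAt x q = v → φ q x = 0 := fun v hv => by
    induction hv using Submodule.span_induction with
    | mem v hv =>
      obtain ⟨p, hp, rfl⟩ := hv
      intro q hq
      have h := apply_eq_zero_of_evalAt_eq_zero φ (x := x) (q := q - p)
        (by rw [map_sub, hq, sub_self])
      simpa [hφ p hp] using h
    | zero => exact fun q => apply_eq_zero_of_evalAt_eq_zero φ
    | add a b _ _ ha hb =>
      intro q hq
      obtain ⟨p, rfl⟩ := Restriction.evalAt_surjective x a
      have h := hb (q - p) (by rw [map_sub, hq, add_sub_cancel_left])
      simpa [ha p rfl] using h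
    | smul c a _ ha =>
      intro q hq
      obtain ⟨p, rfl⟩ := Restriction.evalAt_surjective x a
      have h := apply_eq_zero_of_evalAt_eq_zero φ (x := x)
        (q := q - ContinuousMap.const K c • p) (by simp [evalAt_smul, hq])
      simpa [ha p rfl] using h
  exact key _ (by rw [span_evalAt_image_eq_top hfin hS]; trivial) q rfl

/-- If `E_K` is projective and topologically finitely generated, then it is finitely generated. -/
theorem Restriction.finite_of_projective [Module.Projective C(K, ℂ) (Restriction E K)]
    {S : Set (Restriction E K)} (hfin : S.Finite)
    (hS : Dense (Submodule.span C(K, ℂ) S : Set (Restriction E K))) :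
    Module.Finite C(K, ℂ) (Restriction E K) := by
  classical
  obtain ⟨s, hs⟩ := Module.projective_def.1 ‹Module.Projective C(K, ℂ) (Restriction E K)›
  -- `s` is a section of the canonical map from the free module on `E_K`. Each of the finitely many
  -- generators has finitely many nonzero coordinates under `s`; a coordinate outside their union
  -- `J` is a functional vanishing on `S`, hence zero, so every `q` is a combination of `J`.
  let J : Finset (Restriction E K) := hfin.toFinset.biUnion fun q => (s q).support
  refine ⟨J, eq_top_iff.2 fun q _ => ?_⟩
  have hJ : ∀ p ∉ J, s q p = 0 := fun p hp => by
    have h0 : Finsupp.lapply p ∘ₗ s = 0 := eq_zero_of_forall_mem hfin hS _ fun r hr => by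
      by_contra hne
      exact hp (Finset.mem_biUnion.2 ⟨r, hfin.mem_toFinset.2 hr, Finsupp.mem_support_iff.2 hne⟩)
    exact LinearMap.congr_fun h0 q
  rw [← hs q, Finsupp.linearCombination_apply]
  refine Submodule.sum_mem _ fun p hp => Submodule.smul_mem _ _ (Submodule.subset_span ?_)
  by_contra hpJ
  exact Finsupp.mem_support_iff.1 hp (hJ p hpJ)

/-- Lifts `m` of a basis of the fibre at `x` stay independent nearby because their Gram determinant
is continuous. That they still span is Nakayama's argument, which requires algebraic generators over
a compact neighbourhood of `x`. -/
theorem exists_isFrameOn (hfg : IsSigmaFinitelyGenerated X E) (hproj : IsSigmaProjective X E)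
    (x : X) : ∃ (n : ℕ) (m : Fin n → E) (U : Set X), x ∈ U ∧ IsFrameOn m U := by
  classical
  obtain ⟨K', hK', hxK⟩ := exists_compact_mem_nhds x
  let K : TopologicalSpace.Compacts X := ⟨K', hK'⟩
  let x' : K := ⟨x, mem_of_mem_nhds hxK⟩
  obtain ⟨S, hS⟩ := hfg K
  have := hproj K
  have hfd : FiniteDimensional ℂ (Fiber E x) :=
    ⟨Restriction.span_evalAt_image_eq_top S.finite_toSet hS x' ▸
      Submodule.fg_span (S.finite_toSet.image _)⟩
  obtain ⟨⟨J, hJ⟩⟩ := Restriction.finite_of_projective S.finite_toSet hS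
  have b := Module.finBasis ℂ (Fiber E x)
  choose m hm using fun i => evalAt_surjective x (b i)
  have hli : LinearIndependent ℂ fun i => evalAt x (m i) := by
    simpa only [hm] using b.linearIndependent
  have hsp : Submodule.span ℂ (Set.range fun i => evalAt x (m i)) = ⊤ := by
    simpa only [hm] using b.span_eq
  have hgen : ∀ ξ : E, ∃ a : J → C(K, ℂ), ∑ j, a j • (j : Restriction E K) = Restriction.mk K ξ :=
    fun ξ => by
      have : Restriction.mk K ξ ∈ Submodule.span C(K, ℂ) (J : Set (Restriction E K)) := by
        rw [hJ]; trivial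
      rw [Submodule.mem_span_finset'] at this
      exact this
  choose z hz using fun j : J => Restriction.mk_surjective (j : Restriction E K)
  have hc : ∀ j, ∃ c : Fin _ → ℂ, ∑ i, c i • evalAt x (m i) = evalAt x (z j) := fun j => by
    have : evalAt x (z j) ∈ Submodule.span ℂ (Set.range fun i => evalAt x (m i)) := by
      rw [hsp]; trivial
    exact (Submodule.mem_span_range_iff_exists_fun ℂ).1 this
  choose c hc using hc
  have hr : ∀ j, evalAt x (z j - ∑ i, c j i • m i) = 0 := fun j => by
    rw [map_sub, map_sum, ← hc]; simp
  -- The remainder of each generator vanishes at `x`, so it is `f j • r j` with `f j x = 0`.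
  choose f r hf hfr using fun j => exists_eq_smul (X := X) (z j - ∑ i, c j i • m i)
  choose a ha using fun j => hgen (r j)
  -- Expanding `r j` in the generators again turns the remainder of `z j` into `∑ k, A j k • z k`
  -- over `K`. As `A` vanishes at `x`, `1 - A` is invertible nearby, and there the `z j` lie in the
  -- span of the `m i`.
  let A : K → Matrix J J ℂ := fun y => Matrix.of fun j k => f j y * a j k y
  have hA : Continuous A := continuous_matrix fun j k =>
    ((f j).continuous.comp continuous_subtype_val).mul (a j k).continuous
  have hA0 : A x' = 0 := by
    ext j k
    have : f j x = 0 := hf j x (hr j)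
    simp [A, x', this]
  have hdet : ∀ᶠ y : K in 𝓝 x', (1 - A y).det ≠ 0 :=
    (((continuous_const (y := (1 : Matrix J J ℂ))).sub hA).matrix_det.continuousAt).eventually_ne
      (by rw [Pi.sub_apply, hA0]; simp)
  have hdet' : ∀ᶠ y in 𝓝 x, ∀ hy : y ∈ K, (1 - A ⟨y, hy⟩).det ≠ 0 := by
    rw [nhds_subtype_eq_comap, eventually_comap] at hdet
    filter_upwards [hdet] with y hy hyK using hy ⟨y, hyK⟩ rfl
  have hgram : ∀ᶠ y in 𝓝 x, (gramAt m y).det ≠ 0 :=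
    (continuous_gramAt m).matrix_det.continuousAt.eventually_ne
      (by rw [gramAt_eq]; exact Matrix.det_gram_ne_zero_iff_linearIndependent.2 hli)
  have hspan : ∀ᶠ y in 𝓝 x, Submodule.span ℂ (Set.range fun i => evalAt y (m i)) = ⊤ := by
    filter_upwards [hdet', hxK] with y hy hyK
    have hz' : ∀ j, evalAt y (z j) ∈ Submodule.span ℂ (Set.range fun i => evalAt y (m i)) := by
      refine mem_of_sub_mulVec_mem (hy hyK) fun j => ?_
      have h1 : ∑ k, A ⟨y, hyK⟩ j k • evalAt y (z k) = evalAt y (z j - ∑ i, c j i • m i) := by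
        rw [hfr, evalAt_smul, ← Restriction.evalAt_mk (K := K) ⟨y, hyK⟩, ← ha, map_sum,
          Finset.smul_sum]
        refine Finset.sum_congr rfl fun k _ => ?_
        rw [Restriction.evalAt_smul, ← hz k, Restriction.evalAt_mk, smul_smul]
        rfl
      rw [h1, ← map_sub, sub_sub_cancel, map_sum]
      refine Submodule.sum_mem _ fun i _ => ?_
      rw [map_smul]
      exact Submodule.smul_mem _ _ (Submodule.subset_span ⟨i, rfl⟩)
    refine eq_top_iff.2 fun v _ => ?_
    obtain ⟨ξ, rfl⟩ := evalAt_surjective y v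
    obtain ⟨b, hb⟩ := hgen ξ
    rw [← Restriction.evalAt_mk (K := K) ⟨y, hyK⟩, ← hb, map_sum]
    refine Submodule.sum_mem _ fun k _ => ?_
    rw [Restriction.evalAt_smul, ← hz k, Restriction.evalAt_mk]
    exact Submodule.smul_mem _ _ (hz' k)
  obtain ⟨U, hU, hUo, hxU⟩ := eventually_nhds_iff.1 (hgram.and hspan)
  exact ⟨_, m, U, hxU, hUo, fun y hy => (hU y hy).1, fun y hy => (hU y hy).2⟩

end LocalFrame

end HilbertC0

/-! ### The vector bundle of a Hilbert `C₀(X)`-module -/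

namespace HilbertC0

section Bundle

variable {X : Type u} [TopologicalSpace X] {E : Type v} [NormedAddCommGroup E] [NormedSpace ℂ E]
  [SMul C₀(X, ℂ) E] [CStarModule C₀(X, ℂ) E]

/-- The inner products of a vector in a fibre with all elements of `E`, and its base point. -/
def innerProfile (p : TotalSpace ℂ (Fiber E : X → Type v)) : X × (E → ℂ) :=
  (p.proj, fun ξ => inner ℂ (evalAt p.proj ξ) p.2)

/-- The weakest topology for which the projection and the inner products with elements of `E` are
continuous. -/
instance : TopologicalSpace (TotalSpace ℂ (Fiber E : X → Type v)) :=
  TopologicalSpace.induced innerProfile inferInstance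

theorem continuous_innerProfile :
    Continuous (innerProfile : TotalSpace ℂ (Fiber E : X → Type v) → X × (E → ℂ)) :=
  continuous_induced_dom

theorem continuous_proj_fiber : Continuous (π ℂ (Fiber E : X → Type v)) :=
  continuous_fst.comp continuous_innerProfile

/-- The inner product of a vector in a fibre with the value of `ξ`. -/
def innerWith (ξ : E) (p : TotalSpace ℂ (Fiber E : X → Type v)) : ℂ := inner ℂ (evalAt p.proj ξ) p.2

theorem continuous_innerWith (ξ : E) : Continuous (innerWith (X := X) ξ) :=
  (continuous_apply ξ).comp (continuous_snd.comp continuous_innerProfile)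

namespace IsFrameOn

variable {n : ℕ} {m : Fin n → E} {U : Set X}

/-- The coefficients with respect to the frame of the vector whose inner products with the frame
are given. -/
def solve (m : Fin n → E) (q : X × (Fin n → ℂ)) : Fin n → ℂ := (gramAt m q.1)⁻¹.mulVec q.2

/-- The vector in the fibre at `y` whose inner products with the frame are given. -/
def vector (m : Fin n → E) (y : X) (w : Fin n → ℂ) : Fiber E y :=
  ∑ i, solve m (y, w) i • evalAt y (m i)

theorem inner_vector (h : IsFrameOn m U) {y : X} (hy : y ∈ U) (w : Fin n → ℂ) :
    (fun i => inner ℂ (evalAt y (m i)) (vector m y w)) = w := by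
  have h1 : (fun i => inner ℂ (evalAt y (m i)) (vector m y w)) =
      (gramAt m y).mulVec (solve m (y, w)) := by
    ext i
    simp only [vector, inner_sum, inner_smul_right, Matrix.mulVec, dotProduct, gramAt_eq,
      Matrix.gram_apply]
    exact Finset.sum_congr rfl fun j _ => mul_comm _ _
  rw [h1, solve, Matrix.mulVec_mulVec,
    Matrix.mul_nonsing_inv _ (isUnit_iff_ne_zero.2 (h.det_ne_zero y hy)),
    Matrix.one_mulVec]

/-- By `inner_vector` both sides have the same inner products with the frame, and the frame spans
the fibre. -/
theorem vector_inner (h : IsFrameOn m U) {y : X} (hy : y ∈ U) (v : Fiber E y) :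
    vector m y (fun i => inner ℂ (evalAt y (m i)) v) = v := by
  have h0 : ∀ w ∈ Submodule.span ℂ (Set.range fun i => evalAt y (m i)),
      inner ℂ w (vector m y (fun i => inner ℂ (evalAt y (m i)) v)) = inner ℂ w v := fun w hw => by
    induction hw using Submodule.span_induction with
    | mem w hw =>
      obtain ⟨i, rfl⟩ := hw
      exact congrFun (h.inner_vector hy fun i => inner ℂ (evalAt y (m i)) v) i
    | zero => simp
    | add a b _ _ ha hb => rw [inner_add_left, inner_add_left, ha, hb]
    | smul c a _ ha => rw [inner_smul_left, inner_smul_left, ha]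
  exact ext_inner_left ℂ fun w => h0 w (by rw [h.span_eq_top y hy]; trivial)

theorem continuousOn_gram_inv (h : IsFrameOn m U) :
    ContinuousOn (fun y : X => (gramAt m y)⁻¹) U := fun y hy =>
  ((continuousAt_matrix_inv _ (by
    simpa using NormedRing.inverse_continuousAt (Units.mk0 _ (h.det_ne_zero y hy)))).comp
      (continuous_gramAt m).continuousAt).continuousWithinAt

theorem continuousOn_solve (h : IsFrameOn m U) :
    ContinuousOn (solve (X := X) m) (U ×ˢ Set.univ) := by
  have h1 : ContinuousOn (fun q : X × (Fin n → ℂ) => (gramAt m q.1)⁻¹) (U ×ˢ Set.univ) :=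
    h.continuousOn_gram_inv.comp continuousOn_fst fun q hq => hq.1
  refine continuousOn_pi.2 fun i => ?_
  simp only [solve, Matrix.mulVec, dotProduct]
  refine continuousOn_finsetSum _ fun j _ => ContinuousOn.mul ?_ ?_
  · exact (continuous_id.matrix_elem i j).comp_continuousOn h1
  · exact ((continuous_apply j).comp continuous_snd).continuousOn

/-- The base point of a vector and its inner products with a frame. -/
def innerFrame (m : Fin n → E) (p : TotalSpace ℂ (Fiber E : X → Type v)) : X × (Fin n → ℂ) :=
  (p.proj, fun i => innerWith (m i) p)

theorem continuous_innerFrame (m : Fin n → E) : Continuous (innerFrame (X := X) m) :=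
  continuous_proj_fiber.prodMk (continuous_pi fun i => continuous_innerWith (m i))

theorem continuousAt_solve_innerFrame (h : IsFrameOn m U)
    {p : TotalSpace ℂ (Fiber E : X → Type v)} (hp : p.proj ∈ U) :
    ContinuousAt (fun p => solve m (innerFrame m p)) p :=
  ContinuousAt.comp (g := solve m) (f := innerFrame m)
    (h.continuousOn_solve.continuousAt ((h.isOpen.prod isOpen_univ).mem_nhds ⟨hp, trivial⟩))
    (continuous_innerFrame m).continuousAt

/-- Only `v` is expanded in the frame. Its coefficients and the inner products of `w` with the frame
are each continuous on the total space over `U`, which gives the continuity of the metric. -/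
theorem inner_eq_sum (h : IsFrameOn m U) {y : X} (hy : y ∈ U) (v w : Fiber E y) :
    inner ℂ v w = ∑ i, star (solve m (innerFrame m ⟨y, v⟩) i) * innerWith (m i) ⟨y, w⟩ := by
  conv_lhs => rw [← h.vector_inner hy v]
  simp only [vector, sum_inner, inner_smul_left]
  rfl

/-- The local trivialization of the bundle of fibres given by a frame. -/
def trivialization (h : IsFrameOn m U) :
    Trivialization (Fin n → ℂ) (π ℂ (Fiber E : X → Type v)) where
  -- The coordinates are the inner products with the frame, not the coefficients: they are
  -- continuous by the choice of topology, and the Gram matrix enters only in the inverse.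
  toFun := innerFrame m
  invFun q := ⟨q.1, vector m q.1 q.2⟩
  source := π ℂ (Fiber E : X → Type v) ⁻¹' U
  target := U ×ˢ Set.univ
  map_source' _ hp := ⟨hp, trivial⟩
  map_target' _ hq := hq.1
  left_inv' p hp := by
    obtain ⟨y, v⟩ := p
    exact congrArg (TotalSpace.mk y) (h.vector_inner hp v)
  right_inv' q hq := by
    obtain ⟨y, w⟩ := q
    exact congrArg (Prod.mk y) (h.inner_vector hq.1 w)
  open_source := h.isOpen.preimage continuous_proj_fiber
  open_target := h.isOpen.prod isOpen_univ
  continuousOn_toFun := (continuous_innerFrame m).continuousOn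
  continuousOn_invFun := by
    -- Continuity into the total space is tested on the inner product with each `ξ`, a sum of solved
    -- coefficients times functions `⟨ξ, m i⟩`.
    refine (Topology.IsInducing.mk rfl : IsInducing
      (innerProfile (E := E) (X := X))).continuousOn_iff.2 ?_
    refine continuousOn_fst.prodMk (continuousOn_pi.2 fun ξ => ?_)
    simp only [vector, inner_sum, inner_smul_right, inner_evalAt]
    refine continuousOn_finsetSum _ fun i _ => ContinuousOn.mul ?_ ?_
    · exact (continuous_apply i).comp_continuousOn h.continuousOn_solve
    · exact ((inner C₀(X, ℂ) ξ (m i) : C₀(X, ℂ)).continuous.comp continuous_fst).continuousOn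
  baseSet := U
  open_baseSet := h.isOpen
  source_eq := rfl
  target_eq := rfl
  proj_toFun _ _ := rfl

end IsFrameOn

theorem continuous_inner_fiber
    (hfr : ∀ x : X, ∃ (n : ℕ) (m : Fin n → E) (U : Set X), x ∈ U ∧ IsFrameOn m U) :
    Continuous fun q : TotalSpace (ℂ × ℂ) ((Fiber E : X → Type v) ×ᵇ (Fiber E : X → Type v)) =>
      (inner ℂ q.2.1 q.2.2 : ℂ) := by
  refine continuous_iff_continuousAt.2 fun q₀ => ?_
  obtain ⟨n, m, U, hx, h⟩ := hfr q₀.proj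
  have hdiag := (FiberBundle.Prod.isInducing_diag ℂ (Fiber E : X → Type v) ℂ
    (Fiber E : X → Type v)).continuous
  have h1 := continuous_fst.comp hdiag
  have h2 := continuous_snd.comp hdiag
  have hU := (continuous_proj_fiber.comp h1).continuousAt.eventually (h.isOpen.mem_nhds hx)
  have h3 : ContinuousAt (fun q : TotalSpace (ℂ × ℂ)
      ((Fiber E : X → Type v) ×ᵇ (Fiber E : X → Type v)) =>
        ∑ i, star (IsFrameOn.solve m (IsFrameOn.innerFrame m ⟨q.proj, q.2.1⟩) i) *
          innerWith (m i) ⟨q.proj, q.2.2⟩) q₀ :=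
    tendsto_finsetSum _ fun i _ => Tendsto.mul
      ((continuousAt_pi.1 ((h.continuousAt_solve_innerFrame hx).comp h1.continuousAt) i).star)
      ((continuous_innerWith (m i)).comp h2).continuousAt
  refine h3.congr ?_
  filter_upwards [hU] with q hq
  exact (h.inner_eq_sum hq q.2.1 q.2.2).symm

/-- The vector bundle whose fibres are the fibres of `E`. -/
@[reducible] def toBundle (hnt : ∀ x : X, Nontrivial (Fiber E x))
    (hfr : ∀ x : X, ∃ (n : ℕ) (m : Fin n → E) (U : Set X), x ∈ U ∧ IsFrameOn m U) :
    ComplexVectorBundle.{u, v} X where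
  Fiber := Fiber E
  nontrivial := hnt
  locally_trivial x := by
    obtain ⟨n, m, U, hx, h⟩ := hfr x
    exact ⟨n, h.trivialization, hx, fun y _ =>
      { map_add := fun a b => funext fun i => inner_add_right _ _ _
        map_smul := fun c a => funext fun i => inner_smul_right _ _ _ }⟩

variable (hnt : ∀ x : X, Nontrivial (Fiber E x))
  (hfr : ∀ x : X, ∃ (n : ℕ) (m : Fin n → E) (U : Set X), x ∈ U ∧ IsFrameOn m U)

variable (E) in
/-- The inner product of the fibre at `x`. -/
@[reducible] def fiberCore (x : X) : InnerProductSpace.Core ℂ (Fiber E x) :=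
  InnerProductSpace.toCore

/-- The metric on the bundle of `E` given by the inner products of the fibres. -/
def toMetric : (toBundle hnt hfr).Metric where
  core x := fiberCore E x
  continuous_inner := continuous_inner_fiber hfr

/-- The section of the bundle of `E` given by an element of `E`. -/
def toSection : E →ₗ[ℂ] (toBundle hnt hfr).sectionsC0 (toMetric hnt hfr) where
  toFun ξ := ⟨fun x => evalAt x ξ, by
    refine ⟨continuous_induced_rng.2 (continuous_id.prodMk (continuous_pi fun η => ?_)), ?_⟩
    · exact (inner C₀(X, ℂ) η ξ : C₀(X, ℂ)).continuous
    · exact zero_at_infty (inner C₀(X, ℂ) ξ ξ : C₀(X, ℂ))⟩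
  map_add' ξ η := by ext x; exact map_add _ _ _
  map_smul' c ξ := by ext x; exact map_smul _ _ _

theorem toSection_smul (f : C₀(X, ℂ)) (ξ : E) :
    toSection hnt hfr (f • ξ) = f • toSection hnt hfr ξ :=
  Subtype.ext (funext fun x => evalAt_smul x f ξ)

theorem inner_toSection (ξ η : E) :
    inner C₀(X, ℂ) (toSection hnt hfr ξ) (toSection hnt hfr η) = inner C₀(X, ℂ) ξ η := rfl

theorem norm_toSection (ξ : E) : ‖toSection hnt hfr ξ‖ = ‖ξ‖ := by
  rw [CStarModule.norm_eq_sqrt_norm_inner_self (A := C₀(X, ℂ)), inner_toSection,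
    ← CStarModule.norm_eq_sqrt_norm_inner_self]

end Bundle

end HilbertC0

/-! ### Every section of the bundle of a Hilbert module comes from the module -/

/-- Used twice: to glue local approximations of a section, and to build dual bases over `K`. Off `K`
the sum is only bounded by 1. -/
theorem exists_finset_partition {X : Type u} [TopologicalSpace X] [LocallyCompactSpace X]
    [T2Space X] {K : Set X} (hK : IsCompact K) {U : X → Set X} (hU : ∀ x, IsOpen (U x))
    (hxU : ∀ x, x ∈ U x) :
    ∃ (t : Finset X) (ρ : t → C(X, ℝ)), (∀ i, tsupport (ρ i) ⊆ U i) ∧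
      (∀ i, HasCompactSupport (ρ i)) ∧ (∀ i y, 0 ≤ ρ i y) ∧ (∀ y, ∑ i, ρ i y ≤ 1) ∧
      ∀ y ∈ K, ∑ i, ρ i y = 1 := by
  obtain ⟨t, -, ht⟩ := hK.elim_nhds_subcover U fun x _ => (hU x).mem_nhds (hxU x)
  obtain ⟨ρ, hρU, hρc⟩ := PartitionOfUnity.exists_isSubordinate_of_locallyFinite_t2space hK
    (fun i : t => U i) (fun i => hU i) (locallyFinite_of_finite _)
    (fun x hx => by
      obtain ⟨i, hi, hxi⟩ := Set.mem_iUnion₂.1 (ht hx)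
      exact Set.mem_iUnion.2 ⟨⟨i, hi⟩, hxi⟩)
  refine ⟨t, ρ, hρU, hρc, ρ.nonneg, fun y => ?_, fun y hy => ?_⟩
  · rw [← finsum_eq_sum_of_fintype]
    exact ρ.sum_le_one y
  · rw [← finsum_eq_sum_of_fintype]
    exact ρ.sum_eq_one hy

/-- An isometry from a complete space has closed range, so density of the range gives surjectivity.
-/
theorem bijective_of_norm_eq_of_approx {E F : Type*} [NormedAddCommGroup E] [NormedSpace ℂ E]
    [NormedAddCommGroup F] [NormedSpace ℂ F] [CompleteSpace E] (T : E →ₗ[ℂ] F)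
    (hT : ∀ ξ, ‖T ξ‖ = ‖ξ‖) (h : ∀ s, ∀ ε > 0, ∃ ξ, ‖s - T ξ‖ < ε) : Function.Bijective T := by
  have hiso : Isometry T := AddMonoidHomClass.isometry_of_norm T hT
  refine ⟨hiso.injective, fun s => ?_⟩
  rw [← Set.mem_range, ← hiso.isClosedEmbedding.isClosed_range.closure_eq, Metric.mem_closure_iff]
  intro ε hε
  obtain ⟨ξ, hξ⟩ := h s ε hε
  exact ⟨_, ⟨ξ, rfl⟩, by rwa [dist_eq_norm]⟩

namespace HilbertC0

section Surjective

variable {X : Type u} [TopologicalSpace X] {E : Type v} [NormedAddCommGroup E] [NormedSpace ℂ E]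
  [SMul C₀(X, ℂ) E] [CStarModule C₀(X, ℂ) E] (hnt : ∀ x : X, Nontrivial (Fiber E x))
  (hfr : ∀ x : X, ∃ (n : ℕ) (m : Fin n → E) (U : Set X), x ∈ U ∧ IsFrameOn m U)

/-- The value of a section of the bundle of `E`, as an element of the fibre of `E`. -/
def sectionValue (s : (toBundle hnt hfr).sectionsC0 (toMetric hnt hfr)) (x : X) : Fiber E x := s.1 x

theorem norm_sectionValue_sq (s : (toBundle hnt hfr).sectionsC0 (toMetric hnt hfr)) (x : X) :
    ‖sectionValue hnt hfr s x‖ ^ 2 = ‖(inner C₀(X, ℂ) s s : C₀(X, ℂ)) x‖ := by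
  have h : (inner C₀(X, ℂ) s s : C₀(X, ℂ)) x =
    inner ℂ (sectionValue hnt hfr s x) (sectionValue hnt hfr s x) := rfl
  rw [h, inner_self_eq_norm_sq_to_K, norm_pow]
  simp

theorem norm_section_le {s : (toBundle hnt hfr).sectionsC0 (toMetric hnt hfr)} {c : ℝ}
    (hc : 0 ≤ c) (h : ∀ x, ‖sectionValue hnt hfr s x‖ ≤ c) : ‖s‖ ≤ c := by
  refine le_of_sq_le_sq ?_ hc
  rw [CStarModule.norm_sq_eq C₀(X, ℂ)]
  refine norm_le_of_forall (by positivity) fun x => ?_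
  rw [← norm_sectionValue_sq]
  exact pow_le_pow_left₀ (norm_nonneg _) (h x) 2

theorem continuous_norm_sectionValue (s : (toBundle hnt hfr).sectionsC0 (toMetric hnt hfr)) :
    Continuous fun x => ‖sectionValue hnt hfr s x‖ := by
  have h : (fun x : X => ‖sectionValue hnt hfr s x‖) =
      fun x => √‖(inner C₀(X, ℂ) s s : C₀(X, ℂ)) x‖ := by
    ext x
    rw [← norm_sectionValue_sq, Real.sqrt_sq (norm_nonneg _)]
  rw [h]
  fun_prop

/-- Elements `ξ x` with the value `s(x)` at `x` approximate `s` within `ε` near `x`; finitely many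
are glued over a compact `K` off which `s` is smaller than `ε`. One `ε` bounds the glued errors, the
other the part `(1 - ∑ ρ i) s`, which is zero on `K`. -/
theorem exists_norm_sub_toSection_le [LocallyCompactSpace X] [T2Space X]
    (s : (toBundle hnt hfr).sectionsC0 (toMetric hnt hfr)) {ε : ℝ} (hε : 0 < ε) :
    ∃ ξ : E, ‖s - toSection hnt hfr ξ‖ ≤ 2 * ε := by
  choose ξ hξ using fun x => evalAt_surjective x (sectionValue hnt hfr s x)
  have hsub : ∀ η x, sectionValue hnt hfr (s - toSection hnt hfr η) x =
    sectionValue hnt hfr s x - evalAt x η := fun η x => rfl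
  let U : X → Set X := fun x => {y | ‖sectionValue hnt hfr (s - toSection hnt hfr (ξ x)) y‖ < ε}
  have hU : ∀ x, IsOpen (U x) := fun x =>
    isOpen_lt (continuous_norm_sectionValue hnt hfr _) continuous_const
  have hxU : ∀ x, x ∈ U x := fun x => by
    change ‖_‖ < ε
    rw [hsub, hξ, sub_self, norm_zero]
    exact hε
  have hinf : ∀ᶠ x in cocompact X, ‖sectionValue hnt hfr s x‖ < ε := by
    have h1 := (zero_at_infty (inner C₀(X, ℂ) s s : C₀(X, ℂ))).norm
    rw [norm_zero] at h1
    filter_upwards [h1.eventually (gt_mem_nhds (show (0 : ℝ) < ε ^ 2 by positivity))] with x hx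
    rw [← norm_sectionValue_sq] at hx
    exact lt_of_pow_lt_pow_left₀ 2 hε.le hx
  obtain ⟨K, hK, hKs⟩ := mem_cocompact.1 hinf
  obtain ⟨t, ρ, hρU, hρc, hρ0, hρ1, hρK⟩ := exists_finset_partition hK hU hxU
  refine ⟨∑ i, (ρ i).toC0 (hρc i) • ξ i, norm_section_le hnt hfr (by positivity) fun y => ?_⟩
  have h1 : sectionValue hnt hfr (s - toSection hnt hfr (∑ i, (ρ i).toC0 (hρc i) • ξ i)) y =
      ∑ i, (ρ i y : ℂ) • (sectionValue hnt hfr s y - evalAt y (ξ i)) +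
        ((1 - ∑ i, ρ i y : ℝ) : ℂ) • sectionValue hnt hfr s y := by
    rw [hsub, map_sum]
    simp only [evalAt_smul, smul_sub, Finset.sum_sub_distrib]
    rw [← Finset.sum_smul, Complex.ofReal_sub, Complex.ofReal_sum, sub_smul, Complex.ofReal_one,
      one_smul]
    change _ - ∑ i, (ρ i y : ℂ) • _ = _
    abel
  have h2 : ‖∑ i, (ρ i y : ℂ) • (sectionValue hnt hfr s y - evalAt y (ξ i))‖ ≤ ε := by
    calc _ ≤ ∑ i, ρ i y * ε := norm_sum_le_of_le _ fun i _ => by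
          rw [norm_smul, Complex.norm_real, Real.norm_of_nonneg (hρ0 i y)]
          by_cases hy : y ∈ U i
          · exact mul_le_mul_of_nonneg_left (le_of_lt hy) (hρ0 i y)
          · rw [image_eq_zero_of_notMem_tsupport fun h => hy (hρU i h), zero_mul, zero_mul]
      _ = (∑ i, ρ i y) * ε := (Finset.sum_mul ..).symm
      _ ≤ 1 * ε := by gcongr; exact hρ1 y
      _ = ε := one_mul ε
  have h3 : ‖((1 - ∑ i, ρ i y : ℝ) : ℂ) • sectionValue hnt hfr s y‖ ≤ ε := by
    rw [norm_smul, Complex.norm_real, Real.norm_of_nonneg (sub_nonneg.2 (hρ1 y))]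
    by_cases hy : y ∈ K
    · rw [hρK y hy, sub_self, zero_mul]
      exact hε.le
    · have h4 : ‖sectionValue hnt hfr s y‖ < ε := hKs hy
      have h5 : 0 ≤ ∑ i, ρ i y := Finset.sum_nonneg fun i _ => hρ0 i y
      calc _ ≤ 1 * ε := by gcongr; linarith
        _ = ε := one_mul ε
  rw [h1]
  linarith [norm_add_le (∑ i, (ρ i y : ℂ) • (sectionValue hnt hfr s y - evalAt y (ξ i)))
    (((1 - ∑ i, ρ i y : ℝ) : ℂ) • sectionValue hnt hfr s y)]

theorem toSection_bijective [LocallyCompactSpace X] [T2Space X] [CompleteSpace E] :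
    Function.Bijective (toSection hnt hfr) := by
  refine bijective_of_norm_eq_of_approx (toSection hnt hfr) (norm_toSection hnt hfr)
    fun s ε hε => ?_
  obtain ⟨ξ, hξ⟩ := exists_norm_sub_toSection_le hnt hfr s (ε := ε / 3) (by positivity)
  exact ⟨ξ, by linarith⟩

end Surjective

/-- A full, `σ`-finitely generated and `σ`-projective Hilbert `C₀(X)`-module is the module of
sections of a vector bundle with metric. -/
theorem exists_bundle {X : Type u} [TopologicalSpace X] [LocallyCompactSpace X] [T2Space X]
    {E : Type v} [NormedAddCommGroup E] [NormedSpace ℂ E] [SMul C₀(X, ℂ) E]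
    [CStarModule C₀(X, ℂ) E] [CompleteSpace E] (hfull : IsFull X E)
    (hfg : IsSigmaFinitelyGenerated X E) (hproj : IsSigmaProjective X E) :
    ∃ (V : ComplexVectorBundle.{u, v} X) (β : V.Metric) (T : E ≃ₗ[ℂ] V.sectionsC0 β),
      (∀ (f : C₀(X, ℂ)) (ξ : E), T (f • ξ) = f • T ξ) ∧
      ∀ ξ η : E, inner C₀(X, ℂ) (T ξ) (T η) = inner C₀(X, ℂ) ξ η :=
  ⟨toBundle hfull.nontrivial_fiber (exists_isFrameOn hfg hproj), toMetric _ _,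
    LinearEquiv.ofBijective (toSection _ _) (toSection_bijective _ _), toSection_smul _ _,
    inner_toSection _ _⟩

end HilbertC0

/-! ### The module of sections of a vector bundle -/

namespace ComplexVectorBundle

section CutOff

variable {X : Type u} [TopologicalSpace X] {V : ComplexVectorBundle.{u, w} X} {n : ℕ}
  {e : Trivialization (Fin n → ℂ) (π ℂ V.Fiber)} {ρ : C(X, ℝ)}

/-- The coordinates of a section in a local trivialization, cut off by `ρ`. -/
def cutOffCoord (e : Trivialization (Fin n → ℂ) (π ℂ V.Fiber)) (ρ : C(X, ℝ)) (i : Fin n)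
    (s : ∀ x, V.Fiber x) (y : X) : ℂ := (ρ y : ℂ) * (e ⟨y, s y⟩).2 i

theorem cutOffCoord_congr (e : Trivialization (Fin n → ℂ) (π ℂ V.Fiber)) (ρ : C(X, ℝ))
    (i : Fin n) {s t : ∀ x, V.Fiber x} {y : X} (h : s y = t y) :
    cutOffCoord e ρ i s y = cutOffCoord e ρ i t y := by
  rw [cutOffCoord, cutOffCoord, h]

/-- Outside the base set the coordinates carry no meaning, but every point off the support of `ρ`
has a neighbourhood where the product is zero. -/
theorem continuous_cutOffCoord (hρ : tsupport ρ ⊆ e.baseSet) (i : Fin n) {s : ∀ x, V.Fiber x}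
    (hs : IsContinuousSection s) : Continuous (cutOffCoord e ρ i s) := by
  refine continuous_iff_continuousAt.2 fun y => ?_
  by_cases hy : y ∈ tsupport ρ
  · exact (Complex.continuous_ofReal.comp ρ.continuous).continuousAt.mul
      (continuousAt_pi.1 ((continuousAt_section_iff e s (hρ hy)).1 hs.continuousAt) i)
  · refine (continuousAt_const (y := (0 : ℂ))).congr ?_
    filter_upwards [(isClosed_tsupport ρ).isOpen_compl.mem_nhds hy] with z hz
    simp [cutOffCoord, image_eq_zero_of_notMem_tsupport hz]

theorem trivialization_injective {y : X} (hy : y ∈ e.baseSet) :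
    Function.Injective fun v : V.Fiber y => (e ⟨y, v⟩).2 := fun a b hab => by
  have hsrc : ∀ v : V.Fiber y, (⟨y, v⟩ : TotalSpace ℂ V.Fiber) ∈ e.source := fun v => by
    rw [e.source_eq]; exact hy
  have h1 : e ⟨y, a⟩ = e ⟨y, b⟩ :=
    Prod.ext ((e.proj_toFun _ (hsrc a)).trans (e.proj_toFun _ (hsrc b)).symm) hab
  have h2 := e.injOn (hsrc a) (hsrc b) h1
  exact TotalSpace.mk_injective y h2

theorem trivialization_surjective {y : X} (hy : y ∈ e.baseSet) :
    Function.Surjective fun v : V.Fiber y => (e ⟨y, v⟩).2 := fun c => by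
  have hp : e.toPartialEquiv.symm (y, c) ∈ e.source :=
    e.map_target (by rw [e.target_eq]; exact ⟨hy, trivial⟩)
  have h1 : e (e.toPartialEquiv.symm (y, c)) = (y, c) :=
    e.right_inv (by rw [e.target_eq]; exact ⟨hy, trivial⟩)
  have h2 := e.proj_toFun _ hp
  -- The preimage lies over `y` only up to a proved equality, so it is made a variable before its
  -- base point is identified with `y`.
  generalize e.toPartialEquiv.symm (y, c) = p at h1 h2
  obtain ⟨z, v⟩ := p
  have h3 : z = y := h2.symm.trans (congrArg Prod.fst h1)
  subst h3
  exact ⟨v, congrArg Prod.snd h1⟩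

open Classical in
/-- The vector with the given coordinates in a local trivialization. -/
def vectorOfCoord (e : Trivialization (Fin n → ℂ) (π ℂ V.Fiber)) (y : X) (c : Fin n → ℂ) :
    V.Fiber y :=
  -- The default 0 is never used over the base set, by `trivialization_surjective`.
  if h : ∃ v : V.Fiber y, (e ⟨y, v⟩).2 = c then h.choose else 0

theorem trivialization_vectorOfCoord {y : X} (hy : y ∈ e.baseSet) (c : Fin n → ℂ) :
    (e ⟨y, vectorOfCoord e y c⟩).2 = c := by
  have h := trivialization_surjective hy c
  rw [vectorOfCoord, dif_pos h]
  exact h.choose_spec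

/-- The `i`-th section of the frame given by a local trivialization, cut off by `ρ`. -/
def cutOffFrame (e : Trivialization (Fin n → ℂ) (π ℂ V.Fiber)) (ρ : C(X, ℝ)) (i : Fin n) (y : X) :
    V.Fiber y := (ρ y : ℂ) • vectorOfCoord e y (Pi.single i 1)

theorem trivialization_cutOffFrame
    (he : ∀ y ∈ e.baseSet, IsLinearMap ℂ fun v : V.Fiber y => (e ⟨y, v⟩).2) (i : Fin n) {y : X}
    (hy : y ∈ e.baseSet) : (e ⟨y, cutOffFrame e ρ i y⟩).2 = (ρ y : ℂ) • Pi.single i 1 := by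
  have h := (he y hy).map_smul (ρ y : ℂ) (vectorOfCoord e y (Pi.single i 1))
  rw [trivialization_vectorOfCoord hy] at h
  exact h

theorem isContinuousSection_cutOffFrame
    (he : ∀ y ∈ e.baseSet, IsLinearMap ℂ fun v : V.Fiber y => (e ⟨y, v⟩).2)
    (hρ : tsupport ρ ⊆ e.baseSet) (i : Fin n) :
    IsContinuousSection (cutOffFrame e ρ i) := by
  refine continuous_iff_continuousAt.2 fun y => ?_
  by_cases hy : y ∈ tsupport ρ
  · refine (continuousAt_section_iff e _ (hρ hy)).2 ?_
    have h : ContinuousAt (fun y => (ρ y : ℂ) • (Pi.single i 1 : Fin n → ℂ)) y :=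
      ((Complex.continuous_ofReal.comp ρ.continuous).smul continuous_const).continuousAt
    refine h.congr ?_
    filter_upwards [e.open_baseSet.mem_nhds (hρ hy)] with z hz
    exact (trivialization_cutOffFrame he i hz).symm
  · refine (isContinuousSection_zero (V := V)).continuousAt.congr ?_
    filter_upwards [(isClosed_tsupport ρ).isOpen_compl.mem_nhds hy] with z hz
    simp [cutOffFrame, image_eq_zero_of_notMem_tsupport hz]

variable {β : V.Metric}

theorem cutOffFrame_mem_sectionsC0
    (he : ∀ y ∈ e.baseSet, IsLinearMap ℂ fun v : V.Fiber y => (e ⟨y, v⟩).2)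
    (hρ : tsupport ρ ⊆ e.baseSet) (hc : HasCompactSupport ρ) (i : Fin n) :
    cutOffFrame e ρ i ∈ V.sectionsC0 β := by
  refine ⟨isContinuousSection_cutOffFrame he hρ i, tendsto_const_nhds.congr' ?_⟩
  filter_upwards [hc.isCompact.compl_mem_cocompact] with y hy
  rw [cutOffFrame, image_eq_zero_of_notMem_tsupport hy, Complex.ofReal_zero, zero_smul,
    β.form_self_eq_zero.2 rfl]

theorem eq_sum_vectorOfCoord (he : ∀ y ∈ e.baseSet, IsLinearMap ℂ fun v : V.Fiber y => (e ⟨y, v⟩).2)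
    {y : X} (hy : y ∈ e.baseSet) (v : V.Fiber y) :
    v = ∑ i, (e ⟨y, v⟩).2 i • vectorOfCoord e y (Pi.single i 1) := by
  refine trivialization_injective hy ?_
  have h1 : ∀ w : V.Fiber y, (he y hy).mk' _ w = (e ⟨y, w⟩).2 := fun w => rfl
  change (e ⟨y, v⟩).2 = (e ⟨y, _⟩).2
  rw [← h1, ← h1, map_sum]
  simp only [map_smul]
  have h2 : ∀ i : Fin n, (he y hy).mk' _ (vectorOfCoord e y (Pi.single i 1)) = Pi.single i 1 := fun i => by
    rw [h1, trivialization_vectorOfCoord hy]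
  simp only [h2]
  exact pi_eq_sum_univ' _

/-- The coordinates and the frame each carry one factor `ρ`, whence the square. -/
theorem sum_cutOffCoord_smul_cutOffFrame
    (he : ∀ y ∈ e.baseSet, IsLinearMap ℂ fun v : V.Fiber y => (e ⟨y, v⟩).2)
    (hρ : tsupport ρ ⊆ e.baseSet) (s : ∀ x, V.Fiber x) (y : X) :
    ∑ i, cutOffCoord e ρ i s y • cutOffFrame e ρ i y = ((ρ y) ^ 2 : ℂ) • s y := by
  by_cases hy : y ∈ tsupport ρ
  · conv_rhs => rw [eq_sum_vectorOfCoord he (hρ hy) (s y), Finset.smul_sum]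
    refine Finset.sum_congr rfl fun i _ => ?_
    rw [cutOffCoord, cutOffFrame, smul_smul, smul_smul]
    congr 1
    ring
  · simp [cutOffFrame, image_eq_zero_of_notMem_tsupport hy]

end CutOff

/-! ### Finite dual bases over compact sets -/

section Restriction

variable {X : Type u} [TopologicalSpace X] [LocallyCompactSpace X] [T2Space X]
  {V : ComplexVectorBundle.{u, w} X} {β : V.Metric} {K : TopologicalSpace.Compacts X}

open HilbertC0

/-- The norm on the quotient comes from inner products restricted to `K`, so a class is zero exactly
when the section vanishes on `K`. -/
theorem restriction_mk_eq_iff {s t : V.sectionsC0 β} :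
    Restriction.mk K s = Restriction.mk K t ↔ ∀ y ∈ K, s.1 y = t.1 y := by
  constructor
  · intro h y hy
    rw [Restriction.mk_eq_mk] at h
    have h1 := inner_apply_eq_zero h (s - t) hy
    rw [inner_apply] at h1
    exact sub_eq_zero.1 (β.form_self_eq_zero.1 h1)
  · intro h
    rw [← sub_eq_zero, ← map_sub, ← norm_eq_zero, Restriction.norm_mk]
    have h1 : restrict K (inner C₀(X, ℂ) (s - t) (s - t)) = 0 := by
      ext y
      exact β.form_self_eq_zero.2 (sub_eq_zero.2 (h y y.2))
    rw [h1, norm_zero, Real.sqrt_zero]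

/-- The cut-off coordinates as linear functionals on the restriction of `Γ₀(V)` to `K`. -/
theorem exists_linearMap_cutOffCoord {n : ℕ} {e : Trivialization (Fin n → ℂ) (π ℂ V.Fiber)}
    {ρ : C(X, ℝ)} (he : ∀ y ∈ e.baseSet, IsLinearMap ℂ fun v : V.Fiber y => (e ⟨y, v⟩).2)
    (hρ : tsupport ρ ⊆ e.baseSet) (i : Fin n) :
    ∃ φ : Restriction (V.sectionsC0 β) K →ₗ[C(K, ℂ)] C(K, ℂ),
      ∀ (s : V.sectionsC0 β) (y : K), φ (Restriction.mk K s) y = cutOffCoord e ρ i s.1 y := by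
  let F : Restriction (V.sectionsC0 β) K → C(K, ℂ) := fun q =>
    ⟨fun y => cutOffCoord e ρ i (Function.surjInv Restriction.mk_surjective q).1 y,
      (continuous_cutOffCoord hρ i
        (Function.surjInv Restriction.mk_surjective q).2.1).comp continuous_subtype_val⟩
  have hF : ∀ (s : V.sectionsC0 β) (y : K),
      F (Restriction.mk K s) y = cutOffCoord e ρ i s.1 y := fun s y =>
    cutOffCoord_congr e ρ i 
      (restriction_mk_eq_iff.1 (Function.surjInv_eq Restriction.mk_surjective _) (y : X) y.2)
  -- The relation is required at the single point `y` only, which covers both sums and multiples by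
  -- an extended function of `C(K)`.
  have hlin : ∀ (a b : ℂ) (s t r : V.sectionsC0 β) (y : X), r.1 y = a • s.1 y + b • t.1 y →
      cutOffCoord e ρ i r.1 y = a * cutOffCoord e ρ i s.1 y + b * cutOffCoord e ρ i t.1 y := by
    intro a b s t r y hr
    by_cases hy : y ∈ tsupport ρ
    · have h1 := (he y (hρ hy)).map_add (a • s.1 y) (b • t.1 y)
      have h2 := (he y (hρ hy)).map_smul a (s.1 y)
      have h3 := (he y (hρ hy)).map_smul b (t.1 y)
      rw [cutOffCoord, cutOffCoord, cutOffCoord, hr, h1, h2, h3]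
      simp only [Pi.add_apply, Pi.smul_apply, smul_eq_mul]
      ring
    · simp [cutOffCoord, image_eq_zero_of_notMem_tsupport hy]
  refine ⟨{ toFun := F, map_add' := fun p q => ?_, map_smul' := fun g q => ?_ }, hF⟩
  · obtain ⟨s, rfl⟩ := Restriction.mk_surjective p
    obtain ⟨t, rfl⟩ := Restriction.mk_surjective q
    ext y
    rw [← map_add, ContinuousMap.add_apply, hF, hF, hF,
      hlin 1 1 s t (s + t) y (by simp), one_mul, one_mul]
  · obtain ⟨s, rfl⟩ := Restriction.mk_surjective q
    ext y
    rw [Restriction.smul_mk (f := extend g) (fun x => extend_apply g x.2), RingHom.id_apply,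
      smul_eq_mul, ContinuousMap.mul_apply, hF, hF,
      hlin (g y) 0 s s (extend g • s) y (by simp [smul_apply, extend_apply g y.2]), zero_mul,
      add_zero]

variable (β K) in
/-- Over a compact set, `Γ₀(V)` has a finite dual basis. -/
theorem exists_dual_basis : ∃ (ι : Type u) (_ : Fintype ι)
    (m : ι → Restriction (V.sectionsC0 β) K)
    (φ : ι → Restriction (V.sectionsC0 β) K →ₗ[C(K, ℂ)] C(K, ℂ)),
    ∀ q, ∑ i, φ i q • m i = q := by
  choose n e hx he using V.locally_trivial
  obtain ⟨t, ρ, hρU, hρc, hρ0, -, hρK⟩ :=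
    exists_finset_partition K.isCompact (fun x => (e x).open_baseSet) hx
  -- Square roots, so that the squares produced by `sum_cutOffCoord_smul_cutOffFrame` are the `ρ a`,
  -- which add up to 1 on `K`.
  let σ : t → C(X, ℝ) := fun a => ⟨fun y => √(ρ a y), (ρ a).continuous.sqrt⟩
  have hsupp : ∀ a, tsupport (σ a) ⊆ tsupport (ρ a) := fun a =>
    closure_mono fun y hy h0 => hy (by simp [σ, h0])
  have hσ : ∀ a, tsupport (σ a) ⊆ (e a).baseSet := fun a => (hsupp a).trans (hρU a)
  have hσc : ∀ a, HasCompactSupport (σ a) := fun a =>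
    (hρc a).isCompact.of_isClosed_subset (isClosed_tsupport _) (hsupp a)
  have hσ2 : ∀ a y, ((σ a y : ℂ)) ^ 2 = (ρ a y : ℂ) := fun a y => by
    rw [← Complex.ofReal_pow]
    exact congrArg _ (Real.sq_sqrt (hρ0 a y))
  let b : ∀ a : t, Fin (n a) → V.sectionsC0 β := fun a i =>
    ⟨cutOffFrame (e a) (σ a) i, cutOffFrame_mem_sectionsC0 (he a) (hσ a) (hσc a) i⟩
  choose φ hφ using fun (a : t) (i : Fin (n a)) =>
    exists_linearMap_cutOffCoord (β := β) (K := K) (he a) (hσ a) i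
  refine ⟨Σ a : t, Fin (n a), inferInstance, fun j => Restriction.mk K (b j.1 j.2),
    fun j => φ j.1 j.2, fun q => ?_⟩
  obtain ⟨s, rfl⟩ := Restriction.mk_surjective q
  have h1 : ∀ j : Σ a : t, Fin (n a), φ j.1 j.2 (Restriction.mk K s) • Restriction.mk K (b j.1 j.2) =
      Restriction.mk K (extend (φ j.1 j.2 (Restriction.mk K s)) • b j.1 j.2) := fun j =>
    Restriction.smul_mk (fun x => extend_apply _ x.2) _
  rw [Finset.sum_congr rfl fun j _ => h1 j, ← map_sum, restriction_mk_eq_iff]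
  intro y hy
  have h2 : (∑ j : Σ a : t, Fin (n a),
      extend (φ j.1 j.2 (Restriction.mk K s)) • b j.1 j.2 : V.sectionsC0 β).1 y =
      ∑ a : t, ∑ i, cutOffCoord (e a) (σ a) i s.1 y • cutOffFrame (e a) (σ a) i y := by
    rw [← Finset.univ_sigma_univ, Finset.sum_sigma, AddSubmonoidClass.coe_finsetSum, Finset.sum_apply]
    refine Finset.sum_congr rfl fun a _ => ?_
    rw [AddSubmonoidClass.coe_finsetSum, Finset.sum_apply]
    refine Finset.sum_congr rfl fun i _ => ?_
    rw [smul_apply, extend_apply _ hy, hφ]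
  rw [h2]
  simp only [sum_cutOffCoord_smul_cutOffFrame (he _) (hσ _), hσ2]
  rw [← Finset.sum_smul, ← Complex.ofReal_sum, hρK y hy, Complex.ofReal_one, one_smul]

variable (β) in
theorem isSigmaFinitelyGenerated_sectionsC0 : IsSigmaFinitelyGenerated X (V.sectionsC0 β) := by
  classical
  intro K
  obtain ⟨ι, _, m, φ, h⟩ := exists_dual_basis β K
  let S : Finset (Restriction (V.sectionsC0 β) K) := Finset.univ.image m
  refine ⟨S, ?_⟩
  have h1 : Submodule.span C(K, ℂ) (S : Set (Restriction (V.sectionsC0 β) K)) = ⊤ :=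
    eq_top_iff.2 fun q _ => by
      rw [← h q]
      exact Submodule.sum_mem _ fun i _ => Submodule.smul_mem _ _ (Submodule.subset_span
        (Finset.mem_coe.2 (Finset.mem_image_of_mem m (Finset.mem_univ i))))
  rw [h1]
  exact dense_univ

variable (β) in
-- The dual basis identity says that `q ↦ (φ i q)` splits the map from the finite free module onto
-- `E_K` given by the `m i`.
theorem isSigmaProjective_sectionsC0 : IsSigmaProjective X (V.sectionsC0 β) := by
  intro K
  obtain ⟨ι, _, m, φ, h⟩ := exists_dual_basis β K
  refine Module.Projective.of_split (LinearMap.pi φ) (Fintype.linearCombination C(K, ℂ) m) ?_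
  ext q
  simpa [Fintype.linearCombination_apply] using h q

end Restriction

end ComplexVectorBundle

/-! ### Completeness of the module of sections -/

theorem HilbertC0.cauchySeq_inner_self {X : Type u} [TopologicalSpace X] {E : Type v}
    [NormedAddCommGroup E] [NormedSpace ℂ E] [SMul C₀(X, ℂ) E] [CStarModule C₀(X, ℂ) E] {u : ℕ → E}
    (hu : CauchySeq u) : CauchySeq fun n => (inner C₀(X, ℂ) (u n) (u n) : C₀(X, ℂ)) := by
  obtain ⟨R, hR0, hR⟩ : ∃ R : ℝ, 0 < R ∧ ∀ n, ‖u n‖ ≤ R := by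
    obtain ⟨R, hR0, hR⟩ := cauchySeq_bdd hu
    refine ⟨R + ‖u 0‖, by positivity, fun n => ?_⟩
    have h2 := hR n 0
    rw [dist_eq_norm] at h2
    linarith [norm_le_norm_sub_add (u n) (u 0)]
  refine Metric.cauchySeq_iff.2 fun ε hε => ?_
  obtain ⟨N, hN⟩ := Metric.cauchySeq_iff.1 hu (ε / (2 * R)) (by positivity)
  refine ⟨N, fun m hm n hn => ?_⟩
  have h2 := hN m hm n hn
  rw [dist_eq_norm] at h2 ⊢
  have h3 : (inner C₀(X, ℂ) (u m) (u m) - inner C₀(X, ℂ) (u n) (u n) : C₀(X, ℂ)) =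
      inner C₀(X, ℂ) (u m - u n) (u m) + inner C₀(X, ℂ) (u n) (u m - u n) := by
    simp
  rw [h3]
  calc _ ≤ ‖u m - u n‖ * ‖u m‖ + ‖u n‖ * ‖u m - u n‖ := (norm_add_le _ _).trans
        (add_le_add (CStarModule.norm_inner_le E) (CStarModule.norm_inner_le E))
    _ ≤ ‖u m - u n‖ * R + R * ‖u m - u n‖ := by gcongr <;> exact hR _
    _ = ‖u m - u n‖ * (2 * R) := by ring
    _ < ε / (2 * R) * (2 * R) := by gcongr
    _ = ε := by field_simp

namespace ComplexVectorBundle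

section Complete

variable {X : Type u} [TopologicalSpace X] {V : ComplexVectorBundle.{u, w} X} {β : V.Metric}

open HilbertC0

/-- The inner product with a vector, as a linear functional. -/
def Metric.formRight (β : V.Metric) {x : X} (a : V.Fiber x) : V.Fiber x →ₗ[ℂ] ℂ where
  toFun b := β.form a b
  map_add' := β.form_add_right a
  map_smul' c b := β.form_smul_right a b c

theorem finiteDimensional_fiber (x : X) : FiniteDimensional ℂ (V.Fiber x) := by
  obtain ⟨n, e, hx, he⟩ := V.locally_trivial x
  exact FiniteDimensional.of_injective ((he x hx).mk' _) (trivialization_injective hx)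

variable (β) in
/-- The fibres of a vector bundle with metric are complete. -/
theorem exists_limit_of_cauchy {x : X} (v : ℕ → V.Fiber x)
    (hv : ∀ ε > 0, ∃ N, ∀ m ≥ N, ∀ n ≥ N, ‖β.form (v m - v n) (v m - v n)‖ < ε) :
    ∃ a : V.Fiber x, (∀ b, Tendsto (fun n => β.form b (v n)) atTop (𝓝 (β.form b a))) ∧
      Tendsto (fun n => β.form (v n) (v n)) atTop (𝓝 (β.form a a)) ∧
      ∀ b, Tendsto (fun n => β.form (b - v n) (b - v n)) atTop (𝓝 (β.form (b - a) (b - a))) := by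
  let _ : NormedAddCommGroup (V.Fiber x) :=
    @InnerProductSpace.Core.toNormedAddCommGroup ℂ _ _ _ _ (β.core x)
  let _ : InnerProductSpace ℂ (V.Fiber x) := InnerProductSpace.ofCore (β.core x).toCore
  have hform : ∀ a b : V.Fiber x, β.form a b = inner ℂ a b := fun a b => rfl
  have := finiteDimensional_fiber (V := V) x
  have : CompleteSpace (V.Fiber x) := FiniteDimensional.complete ℂ _
  have hcau : CauchySeq v := by
    refine Metric.cauchySeq_iff.2 fun ε hε => ?_
    obtain ⟨N, hN⟩ := hv (ε ^ 2) (by positivity)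
    refine ⟨N, fun m hm n hn => ?_⟩
    have h := hN m hm n hn
    rw [hform, inner_self_eq_norm_sq_to_K, norm_pow] at h
    rw [dist_eq_norm]
    refine lt_of_pow_lt_pow_left₀ 2 hε.le ?_
    simpa using h
  obtain ⟨a, ha⟩ := cauchySeq_tendsto_of_complete hcau
  exact ⟨a, fun b => tendsto_const_nhds.inner ha, ha.inner ha,
    fun b => (tendsto_const_nhds.sub ha).inner (tendsto_const_nhds.sub ha)⟩

theorem norm_form_self_le (s : V.sectionsC0 β) (x : X) : ‖β.form (s.1 x) (s.1 x)‖ ≤ ‖s‖ ^ 2 := by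
  rw [CStarModule.norm_sq_eq C₀(X, ℂ)]
  exact norm_apply_le (inner C₀(X, ℂ) s s) x

theorem norm_section_le_of_forall {s : V.sectionsC0 β} {c : ℝ} (hc : 0 ≤ c)
    (h : ∀ x, ‖β.form (s.1 x) (s.1 x)‖ ≤ c ^ 2) : ‖s‖ ≤ c := by
  refine le_of_sq_le_sq ?_ hc
  rw [CStarModule.norm_sq_eq C₀(X, ℂ)]
  exact norm_le_of_forall (by positivity) h

theorem tendsto_apply_of_tendsto {f : ℕ → C₀(X, ℂ)} {g : C₀(X, ℂ)} (h : Tendsto f atTop (𝓝 g))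
    (x : X) : Tendsto (fun n => f n x) atTop (𝓝 (g x)) := by
  rw [tendsto_iff_norm_sub_tendsto_zero] at h ⊢
  exact squeeze_zero (fun _ => norm_nonneg _) (fun n => norm_apply_le (f n - g) x) h

variable [LocallyCompactSpace X] [T2Space X]

variable (β) in
/-- Local frames of `V` by sections vanishing at infinity. -/
theorem exists_local_frame (x : X) :
    ∃ (n : ℕ) (e : Trivialization (Fin n → ℂ) (π ℂ V.Fiber)) (b : Fin n → V.sectionsC0 β)
      (ρ : C(X, ℝ)), x ∈ e.baseSet ∧
      (∀ y ∈ e.baseSet, IsLinearMap ℂ fun v : V.Fiber y => (e ⟨y, v⟩).2) ∧ ρ x = 1 ∧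
      ∀ y ∈ e.baseSet, ∀ i, (e ⟨y, (b i).1 y⟩).2 = (ρ y : ℂ) • Pi.single i 1 := by
  obtain ⟨n, e, hx, he⟩ := V.locally_trivial x
  obtain ⟨L, hL, hxL, hLe⟩ := exists_compact_subset e.open_baseSet hx
  obtain ⟨ρ, hρ1, hρ0, hρc, -⟩ := exists_continuous_one_zero_of_isCompact
    (isCompact_singleton (x := x)) isOpen_interior.isClosed_compl
    (Set.disjoint_compl_right_iff_subset.2 (Set.singleton_subset_iff.2 hxL))
  have hsupp : tsupport ρ ⊆ e.baseSet := by
    refine Set.Subset.trans (closure_minimal (fun y hy => ?_) hL.isClosed) hLe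
    by_contra hyL
    exact hy (hρ0 fun h => hyL (interior_subset h))
  exact ⟨n, e, fun i => ⟨_, cutOffFrame_mem_sectionsC0 he hsupp hρc i⟩, ρ, hx, he, hρ1 rfl,
    fun y hy i => trivialization_cutOffFrame he i hy⟩

/-- A section is continuous if its inner products with all continuous sections vanishing at
infinity are continuous. -/
theorem isContinuousSection_of_form (s : ∀ x, V.Fiber x)
    (h : ∀ b : V.sectionsC0 β, Continuous fun x => β.form (b.1 x) (s x)) :
    IsContinuousSection s := by
  refine continuous_iff_continuousAt.2 fun x => ?_
  obtain ⟨n, e, b, ρ, hx, he, hρ, hb⟩ := exists_local_frame β x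
  refine (continuousAt_section_iff e s hx).2 ?_
  have hmk : ∀ y (hy : y ∈ e.baseSet) (v : V.Fiber y), (he y hy).mk' _ v = (e ⟨y, v⟩).2 :=
    fun y hy v => rfl
  -- As `ρ x = 1`, the `b i` have the standard unit vectors as coordinates at `x`, so their values
  -- there are independent.
  have hdet : (gramAt b x).det ≠ 0 := by
    rw [gramAt_eq, Matrix.det_gram_ne_zero_iff_linearIndependent, Fintype.linearIndependent_iff]
    intro c hc i
    have h1 : evalAt x (∑ i, c i • b i) = 0 := by rw [map_sum]; simpa using hc
    rw [← inner_self_eq_zero (𝕜 := ℂ), inner_evalAt, inner_apply, β.form_self_eq_zero,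
      AddSubmonoidClass.coe_finsetSum, Finset.sum_apply] at h1
    have h2 := congrArg ((he x hx).mk' _) h1
    rw [map_sum, map_zero] at h2
    have h3 : ∀ i, (he x hx).mk' _ ((c i • b i : V.sectionsC0 β).1 x) = Pi.single i (c i) := fun i => by
      have : (c i • b i : V.sectionsC0 β).1 x = c i • (b i).1 x := rfl
      rw [this, map_smul, hmk x hx, hb x hx, hρ]
      simp [← Pi.single_smul]
    simp only [h3] at h2
    simpa using congrFun h2 i
  have hev : ∀ᶠ y in 𝓝 x, y ∈ e.baseSet ∧ (gramAt b y).det ≠ 0 :=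
    (e.open_baseSet.eventually_mem hx).and
      ((continuous_gramAt b).matrix_det.continuousAt.eventually_ne hdet)
  have hinv : ContinuousAt (fun y => (gramAt b y)⁻¹) x :=
    ContinuousAt.comp (f := gramAt b) (continuousAt_matrix_inv _ (by
      simpa using NormedRing.inverse_continuousAt (Units.mk0 _ hdet)))
      (continuous_gramAt b).continuousAt
  -- If `c` are the coordinates of `s y` in `e`, then `ρ(y) s(y) = ∑ c i b i (y)`. Pairing with the
  -- `b i` gives `G c = ρ(y) ⟨b, s⟩(y)` with `G` the Gram matrix, so the expression here equals `c`
  -- near `x`.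
  have hcont : ContinuousAt (fun y => (ρ y : ℂ) •
      (gramAt b y)⁻¹.mulVec fun i => β.form ((b i).1 y) (s y)) x := by
    refine (Complex.continuous_ofReal.comp ρ.continuous).continuousAt.smul ?_
    refine continuousAt_pi.2 fun i => ?_
    simp only [Matrix.mulVec, dotProduct]
    exact tendsto_finsetSum _ fun j _ => Tendsto.mul
      (((continuous_id.matrix_elem i j).tendsto _).comp hinv) (h (b j)).continuousAt
  refine hcont.congr ?_
  filter_upwards [hev] with y hy
  obtain ⟨hye, hyd⟩ := hy
  have hs : (ρ y : ℂ) • s y = ∑ i, (e ⟨y, s y⟩).2 i • (b i).1 y := by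
    refine trivialization_injective hye ?_
    change (e ⟨y, _⟩).2 = (e ⟨y, _⟩).2
    rw [← hmk y hye, ← hmk y hye, map_sum, map_smul, hmk y hye]
    simp only [map_smul]
    simp only [hmk y hye, hb y hye]
    conv_lhs => rw [pi_eq_sum_univ' (e ⟨y, s y⟩).2, Finset.smul_sum]
    exact Finset.sum_congr rfl fun i _ => smul_comm _ _ _
  have hG : (ρ y : ℂ) • (fun i => β.form ((b i).1 y) (s y)) =
      (gramAt b y).mulVec (e ⟨y, s y⟩).2 := by
    ext i
    have h1 : ∀ c : Fin n → ℂ, β.form ((b i).1 y) (∑ j, c j • (b j).1 y) =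
        ∑ j, c j * β.form ((b i).1 y) ((b j).1 y) := fun c =>
      (map_sum (β.formRight ((b i).1 y)) (fun j => c j • (b j).1 y) Finset.univ).trans
        (Finset.sum_congr rfl fun j _ => β.form_smul_right _ _ _)
    rw [Pi.smul_apply, smul_eq_mul, ← β.form_smul_right, hs, h1]
    exact Finset.sum_congr rfl fun j _ => mul_comm _ _
  rw [← Matrix.mulVec_smul, hG, Matrix.mulVec_mulVec,
    Matrix.nonsing_inv_mul _ (isUnit_iff_ne_zero.2 hyd), Matrix.one_mulVec]

variable (β) in
-- The limit is taken fibrewise. Its inner products with sections, and with itself, are limits in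
-- `C₀(X)`: the former give continuity, the latter vanishing at infinity.
theorem completeSpace_sectionsC0 : CompleteSpace (V.sectionsC0 β) := by
  refine Metric.complete_of_cauchySeq_tendsto fun u hu => ?_
  have hcau : ∀ x, ∀ ε > 0, ∃ N, ∀ m ≥ N, ∀ n ≥ N,
      ‖β.form ((u m).1 x - (u n).1 x) ((u m).1 x - (u n).1 x)‖ < ε := fun x ε hε => by
    obtain ⟨N, hN⟩ := Metric.cauchySeq_iff.1 hu (√ε) (Real.sqrt_pos.2 hε)
    refine ⟨N, fun m hm n hn => ?_⟩
    have h1 := hN m hm n hn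
    rw [dist_eq_norm] at h1
    calc _ ≤ ‖u m - u n‖ ^ 2 := norm_form_self_le (u m - u n) x
      _ < √ε ^ 2 := by gcongr
      _ = ε := Real.sq_sqrt hε.le
  choose s hform hself hsub using fun x => exists_limit_of_cauchy β (fun n => (u n).1 x) (hcau x)
  have hsc : IsContinuousSection s := by
    refine isContinuousSection_of_form (β := β) s fun b => ?_
    have h1 : CauchySeq fun n => (inner C₀(X, ℂ) b (u n) : C₀(X, ℂ)) :=
      hu.map (CStarModule.innerSL (A := C₀(X, ℂ)) b).uniformContinuous
    obtain ⟨g, hg⟩ := cauchySeq_tendsto_of_complete h1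
    have h2 : (fun x => β.form (b.1 x) (s x)) = g := funext fun x =>
      tendsto_nhds_unique (hform x (b.1 x)) (tendsto_apply_of_tendsto hg x)
    rw [h2]
    exact g.continuous
  have hs0 : Tendsto (fun x => β.form (s x) (s x)) (cocompact X) (𝓝 0) := by
    have h1 : CauchySeq fun n => (inner C₀(X, ℂ) (u n) (u n) : C₀(X, ℂ)) := cauchySeq_inner_self hu
    obtain ⟨g, hg⟩ := cauchySeq_tendsto_of_complete h1
    have h2 : (fun x => β.form (s x) (s x)) = g := funext fun x =>
      tendsto_nhds_unique (hself x) (tendsto_apply_of_tendsto hg x)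
    rw [h2]
    exact zero_at_infty g
  refine ⟨⟨s, hsc, hs0⟩, Metric.tendsto_atTop.2 fun ε hε => ?_⟩
  obtain ⟨N, hN⟩ := Metric.cauchySeq_iff.1 hu (ε / 2) (half_pos hε)
  refine ⟨N, fun n hn => ?_⟩
  rw [dist_eq_norm]
  refine (norm_section_le_of_forall (half_pos hε).le fun x => ?_).trans_lt (half_lt_self hε)
  -- Norm convergence follows by letting `m → ∞` at each point in the bound for `u n - u m`, which
  -- is uniform in `x`.
  refine le_of_tendsto (hsub x ((u n).1 x)).norm ?_
  filter_upwards [eventually_ge_atTop N] with m hm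
  have h1 := hN n hn m hm
  rw [dist_eq_norm] at h1
  exact (norm_form_self_le (u n - u m) x).trans (pow_le_pow_left₀ (norm_nonneg _) h1.le 2)

end Complete

end ComplexVectorBundle

end

theorem mainTheorem7 {X : Type u} [TopologicalSpace X] [LocallyCompactSpace X] [T2Space X] :
    (∀ (V : ComplexVectorBundle.{u, w} X) (β : V.Metric),
      CompleteSpace (V.sectionsC0 β) ∧
      HilbertC0.IsSigmaFinitelyGenerated X (V.sectionsC0 β) ∧
      HilbertC0.IsSigmaProjective X (V.sectionsC0 β)) ∧
    (∀ (E : Type v) [NormedAddCommGroup E] [NormedSpace ℂ E] [SMul C₀(X, ℂ) E]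
      [CStarModule C₀(X, ℂ) E] [CompleteSpace E],
      HilbertC0.IsFull X E →
      HilbertC0.IsSigmaFinitelyGenerated X E →
      HilbertC0.IsSigmaProjective X E →
      ∃ (V : ComplexVectorBundle.{u, v} X) (β : V.Metric) (T : E ≃ₗ[ℂ] V.sectionsC0 β),
        (∀ (f : C₀(X, ℂ)) (ξ : E), T (f • ξ) = f • T ξ) ∧
        ∀ ξ η : E, inner C₀(X, ℂ) (T ξ) (T η) = inner C₀(X, ℂ) ξ η) := by
  refine ⟨fun V β => ⟨ComplexVectorBundle.completeSpace_sectionsC0 β,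
    ComplexVectorBundle.isSigmaFinitelyGenerated_sectionsC0 β,
    ComplexVectorBundle.isSigmaProjective_sectionsC0 β⟩, ?_⟩
  intro E _ _ _ _ _ hfull hfg hproj
  exact HilbertC0.exists_bundle hfull hfg hproj
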